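/- Let $0\le p<q$ be real numbers, let $f$ be holomorphic on $D(0,r)=\{|z|<r\}$ for some $r>0$, let $\varepsilon\in(0,r)$ and $k\in\mathbb{N}_0$. Let $D_{p,q}f(z)=\frac{f(pz)-f(qz)}{pz-qz}$ for $z\ne0$, $D_{p,q}f(0)=f'(0)$, and let $D_{p,q}^k$ be its $k$-th iterate. For $x>1$ put $$E_x(z)=\sum_{n\ge0}\frac{z^n}{x^{n(n-1)/2}},\qquad \Theta_x(z)=\sum_{n\in\mathbb{Z}}\frac{z^n}{x^{n(n-1)/2}},\qquad \exp_x(z)=\sum_{n\ge0}\frac{z^n}{[n]_x^!},$$ where $[n]_x^!=\prod_{j=1}^n(1+x+\dots+x^{j-1})$. For $\theta\in\mathbb{R}$ let $L_\theta=[0,\infty)e^{i\theta}$. In the formulas below the direction $\theta$ may be fixed or may depend on $\omega$; it is required that $\arg(\omega)+\theta\not\equiv\pi \pmod{2\pi}$ for all $\omega$ with $|\omega|=\varepsilon$, with at most finitely many exceptions (for a fixed $\theta$ there is exactly one). 1. Let $p=0$ and $q>1$. There are $\alpha\in\mathbb{R}$ for which some $K>0$ satisfies $|E_q(z)|\le K\exp\left(\frac{\log^2|z|}{2\log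 q}\right)|z|^\alpha$ for all $z\neq0$, and for every such $\alpha$ and every $|z|<q^{-k}\varepsilon\min\{1,q^{\frac12-\alpha}\}$, $$D_{0,q}^kf(z)=\frac{q}{2\pi i\log q}\oint_{|\omega|=\varepsilon}f(\omega)\int_{L_\theta}\zeta^k\frac{E_q(z\zeta)}{\Theta_q(q\omega\zeta)}\,d\zeta\,d\omega.$$ 2. Let $p>0$. For every $|z|<q^{-k}\varepsilon$, $$D_{p,q}^kf(z)=\frac{p^{k(k-1)/2}\,(q/p-1)}{2\pi i\log(q/p)}\oint_{|\omega|=\varepsilon}f(\omega)\int_{L_\theta}\zeta^k\frac{\exp_{q/p}(p^kz\zeta)}{\exp_{q/p}\left(\frac qp\omega\zeta\right)}\,d\zeta\,d\omega.$$ In both cases the inner integral converges absolutely for every non-exceptional $\omega$ with $|\omega|=\varepsilon$, and the outer integrand is integrable on the circle. -/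

import Mathlib

open MeasureTheory Set

noncomputable section

namespace PQ

/-- The `(p,q)`-derivative `(f(pz) - f(qz)) / (pz - qz)`. At `z = 0` the quotient is replaced by its
limit `f'(0)`, as usual, so that the operator can be iterated on functions holomorphic at `0`. -/
def pqDeriv (p q : ℝ) (f : ℂ → ℂ) (z : ℂ) : ℂ :=
  if z = 0 then deriv f 0
  else (f ((p : ℂ) * z) - f ((q : ℂ) * z)) / ((p : ℂ) * z - (q : ℂ) * z)

/-- The `q`-number `[n]_q = 1 + q + ⋯ + q ^ (n - 1)`. -/
def qNumber (q : ℝ) (n : ℕ) : ℝ := ∑ j ∈ Finset.range n, q ^ j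

/-- The `q`-factorial `[n]_q! = [1]_q [2]_q ⋯ [n]_q`. -/
def qFactorial (q : ℝ) (n : ℕ) : ℝ := ∏ j ∈ Finset.range n, qNumber q (j + 1)

/-- The `q`-exponential `exp_q(z) = ∑_{n ≥ 0} z ^ n / [n]_q!`. -/
def qExp (q : ℝ) (z : ℂ) : ℂ := ∑' n : ℕ, z ^ n / (qFactorial q n : ℂ)

/-- `E_q(z) = ∑_{n ≥ 0} z ^ n / q ^ (n (n - 1) / 2)`. -/
def qE (q : ℝ) (z : ℂ) : ℂ := ∑' n : ℕ, z ^ n / (q : ℂ) ^ (n * (n - 1) / 2)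

/-- The Jacobi Theta function `Θ_q(z) = ∑_{n ∈ ℤ} z ^ n / q ^ (n (n - 1) / 2)`. The number
`n (n - 1)` is even, so the integer division is exact. -/
def qTheta (q : ℝ) (z : ℂ) : ℂ := ∑' n : ℤ, z ^ n / (q : ℂ) ^ (n * (n - 1) / 2)

/-- `α` is a growth exponent of `E_q`: for some `K > 0`,
`|E_q(z)| ≤ K exp(log² |z| / (2 log q)) |z| ^ α` for all `z ≠ 0`. -/
def IsGrowthExponent (q α : ℝ) : Prop :=
  ∃ K : ℝ, 0 < K ∧ ∀ z : ℂ, z ≠ 0 →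
    ‖qE q z‖ ≤ K * Real.exp (Real.log ‖z‖ ^ 2 / (2 * Real.log q)) * ‖z‖ ^ α

/-- Absolute convergence of the integral of `g` along the ray `L_θ = [0, ∞) e^{iθ}`. -/
def RayIntegrable (θ : ℝ) (g : ℂ → ℂ) : Prop :=
  IntegrableOn (fun t : ℝ => g ((t : ℂ) * Complex.exp ((θ : ℂ) * Complex.I))) (Ioi (0 : ℝ))

/-- The integral of `g` along the ray `L_θ = [0, ∞) e^{iθ}`. -/
def rayIntegral (θ : ℝ) (g : ℂ → ℂ) : ℂ :=
  ∫ t in Ioi (0 : ℝ), g ((t : ℂ) * Complex.exp ((θ : ℂ) * Complex.I)) *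
    Complex.exp ((θ : ℂ) * Complex.I)

/-- `arg ω + θ ≠ ± π`, understood modulo `2π`: the ray `ω L_θ` is not the negative real axis. -/
def IsGoodDirection (ω : ℂ) (θ : ℝ) : Prop :=
  ∀ m : ℤ, Complex.arg ω + θ ≠ (2 * (m : ℝ) + 1) * Real.pi

end PQ

end

noncomputable section

namespace PQ

open Filter Topology

/-! The operator is diagonal on monomials: `k` applications turn `a (n + k)` into the `n`-th
coefficient, multiplied by a product of `(p,q)`-numbers, and `a (n + k)` is a Cauchy integral of `f
ω * (ω ^ (n + k + 1))⁻¹`. That negative power of `ω` is, up to a constant, a moment `∫ ζ ^ (n + k) /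
D (s ω ζ) dζ` along a ray, with `s = q`, `D = Θ_q` if `p = 0` and `s = q / p`, `D = exp_{q/p}` if `p
> 0`. The moment constants times the coefficients of `E_q` or `exp_{q/p}` are precisely the required
products, so summing over `n` under both integrals yields the kernel
(`eq_circleIntegral_rayIntegral`).

The moments come from the equations `Θ(xz) = xz Θ(z)` and `exp(xz) = (1 + (x - 1)z) exp(z)`. The
substitution `t ↦ xt` gives a recursion in the exponent (`moment_qTheta_succ`, `moment_qExp_succ`),
and the zeroth moment is a Frullani integral, the source of the logarithm. The same recursion for
absolute moments makes the interchange legitimate, by a ratio test with limit `q ^ k * ‖z‖ / ε`.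

For this `1 / D` must be finite and rapidly decreasing on rays off the negative axis. Nonvanishing
follows for `exp` from its functional equation and for `Θ` from a limiting form of the Jacobi triple
product (`tendsto_prod_mul_qProd`). The functional equations then give `k t ^ N ≤ |D (tc)|` for
every `N`. -/

/-- A continuous positive function on `(0, ∞)` that does not decrease under `t ↦ x t` for large `t`
is bounded below by a positive constant on every `[δ, ∞)`. -/
lemma exists_pos_le_of_le_comp_mul {x T : ℝ} (hx : 1 < x) (hT : 0 < T) {g : ℝ → ℝ}
    (hg : ContinuousOn g (Ioi 0)) (hpos : ∀ t, 0 < t → 0 < g t)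
    (hmono : ∀ t, T ≤ t → g t ≤ g (x * t)) {δ : ℝ} (hδ : 0 < δ) :
    ∃ c, 0 < c ∧ ∀ t, δ ≤ t → c ≤ g t := by
  have hx0 : 0 < x := by linarith
  obtain ⟨s, hs, hmin⟩ := (isCompact_Icc (a := min δ T) (b := x * T)).exists_isMinOn
    ⟨T, min_le_right _ _, by nlinarith⟩
    (hg.mono fun t ht => lt_of_lt_of_le (lt_min hδ hT) ht.1)
  refine ⟨g s, hpos s (lt_of_lt_of_le (lt_min hδ hT) hs.1), fun t ht => ?_⟩
  -- Dividing by `x` moves any `t` into the compact interval `[min δ T, x T]`, where the minimum is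
  -- attained, and never increases `g` on the way.
  have key : ∀ n : ℕ, ∀ t, min δ T ≤ t → t ≤ x ^ n * (x * T) → g s ≤ g t := by
    intro n
    induction n with
    | zero => exact fun t h1 h2 => hmin ⟨h1, by simpa using h2⟩
    | succ n ih =>
      intro t h1 h2
      by_cases h3 : t ≤ x * T
      · exact hmin ⟨h1, h3⟩
      · have h4 : T ≤ t / x := by rw [le_div_iff₀ hx0]; linarith
        have h5 : g (t / x) ≤ g t := by
          have := hmono _ h4
          rwa [mul_div_cancel₀ _ hx0.ne'] at this
        refine (ih _ ((min_le_right _ _).trans h4) ?_).trans h5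
        rw [div_le_iff₀ hx0]
        calc t ≤ x ^ (n + 1) * (x * T) := h2
          _ = x ^ n * (x * T) * x := by ring
  obtain ⟨n, hn⟩ := pow_unbounded_of_one_lt (t / (x * T)) hx
  exact key n t ((min_le_left _ _).trans ht) ((div_lt_iff₀ (by positivity)).1 hn).le

lemma summable_of_norm_succ_le {E : Type*} [NormedAddCommGroup E] [CompleteSpace E] {u : ℕ → E}
    {ρ : ℕ → ℝ} {l : ℝ} (hl : l < 1) (hρ : Tendsto ρ atTop (𝓝 l))
    (h : ∀ n, ‖u (n + 1)‖ ≤ ρ n * ‖u n‖) : Summable u := by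
  obtain ⟨r, hr, hr1⟩ := exists_between hl
  refine summable_of_ratio_norm_eventually_le hr1 ?_
  filter_upwards [hρ.eventually_le_const hr] with n hn
  exact (h n).trans (mul_le_mul_of_nonneg_right hn (norm_nonneg _))

lemma continuous_tsum_powerSeries {b : ℕ → ℂ} (hb : ∀ R : ℝ, Summable fun n => ‖b n‖ * R ^ n) :
    Continuous fun z : ℂ => ∑' n, b n * z ^ n := by
  refine continuous_iff_continuousAt.2 fun z => ?_
  have : ContinuousOn (fun z : ℂ => ∑' n, b n * z ^ n) (Metric.ball 0 (‖z‖ + 1)) := by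
    refine continuousOn_tsum (fun n => by fun_prop) (hb (‖z‖ + 1)) fun n w hw => ?_
    rw [norm_mul, norm_pow]
    gcongr
    simpa using (mem_ball_zero_iff.1 hw).le
  exact this.continuousAt (Metric.isOpen_ball.mem_nhds (by simp))

/-! ### Series and functional equations of `E_x`, `Θ_x` and `exp_x`. -/

section Basic

variable {x : ℝ}

lemma summable_qE_norm (hx : 1 < x) (R : ℝ) :
    Summable fun n : ℕ => ‖((x : ℂ) ^ (n * (n - 1) / 2))⁻¹‖ * R ^ n := by
  have hx0 : 0 < x := by linarith
  refine summable_of_norm_succ_le (ρ := fun n => |R| * (x⁻¹) ^ n) (l := |R| * 0) (by simp)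
    ((tendsto_pow_atTop_nhds_zero_of_lt_one (by positivity)
      (inv_lt_one_of_one_lt₀ hx)).const_mul _) fun n => le_of_eq ?_
  rw [Nat.triangle_succ]
  simp only [norm_mul, norm_inv, norm_pow, Complex.norm_real, Real.norm_eq_abs,
    abs_of_pos hx0, pow_add, inv_pow, mul_inv, pow_one]
  ring

lemma hasSum_qE (hx : 1 < x) (z : ℂ) :
    HasSum (fun n : ℕ => ((x : ℂ) ^ (n * (n - 1) / 2))⁻¹ * z ^ n) (qE x z) := by
  have : Summable (fun n : ℕ => ((x : ℂ) ^ (n * (n - 1) / 2))⁻¹ * z ^ n) := by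
    refine Summable.of_norm ?_
    simpa only [norm_mul, norm_pow] using summable_qE_norm hx ‖z‖
  convert! this.hasSum using 1
  exact tsum_congr fun n => by rw [div_eq_inv_mul]

lemma continuous_qE (hx : 1 < x) : Continuous (qE x) := by
  convert! continuous_tsum_powerSeries (summable_qE_norm hx) using 1
  funext z
  exact (hasSum_qE hx z).tsum_eq.symm

lemma qE_zero (hx : 1 < x) : qE x 0 = 1 := by
  have := (hasSum_qE hx 0).unique (hasSum_single 0 fun n hn => by simp [hn])
  simpa using this

lemma qE_mul (hx : 1 < x) (z : ℂ) : qE x (x * z) = 1 + x * z * qE x z := by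
  have hx0 : (x : ℂ) ≠ 0 := by exact_mod_cast (by linarith : x ≠ 0)
  refine (hasSum_qE hx _).unique ((hasSum_nat_add_iff' 1).1 ?_)
  convert! (hasSum_qE hx z).mul_left (x * z) using 1
  · funext n
    rw [Nat.triangle_succ, pow_add, mul_pow, pow_succ, pow_succ]
    field_simp
  · simp

/-- The term of index `-(n + 1)` is `z` times the term of index `n + 2` of `E_x(z⁻¹)`. The two
missing initial terms account for `- z - 1`. -/
lemma hasSum_qTheta (hx : 1 < x) {z : ℂ} (hz : z ≠ 0) :
    HasSum (fun n : ℤ => z ^ n / (x : ℂ) ^ (n * (n - 1) / 2))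
      (qE x z + z * qE x z⁻¹ - z - 1) := by
  have hx0 : (x : ℂ) ≠ 0 := by exact_mod_cast (by linarith : x ≠ 0)
  have h1 := hasSum_qE hx z
  have h2 := (hasSum_nat_add_iff' 2).2 (hasSum_qE hx z⁻¹)
  have h3 := h2.mul_left z
  have := HasSum.of_nat_of_neg_add_one (f := fun n : ℤ => z ^ n / (x : ℂ) ^ (n * (n - 1) / 2))
    (m := qE x z) (m' := z * (qE x z⁻¹ - ∑ i ∈ Finset.range 2,
      ((x : ℂ) ^ (i * (i - 1) / 2))⁻¹ * z⁻¹ ^ i)) ?_ ?_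
  · convert! this using 1
    simp [Finset.sum_range_succ]
    field_simp
    ring
  · convert! h1 using 1
    funext n
    have : ((n : ℤ) * ((n : ℤ) - 1) / 2) = ((n * (n - 1) / 2 : ℕ) : ℤ) := by
      cases n with
      | zero => simp
      | succ n => push_cast; simp
    simp only [this, zpow_natCast, div_eq_inv_mul]
  · convert! h3 using 1
    funext n
    have : (-((n : ℤ) + 1) * (-((n : ℤ) + 1) - 1) / 2) = (((n + 2) * (n + 2 - 1) / 2 : ℕ) : ℤ) := by
      push_cast [show n + 2 - 1 = n + 1 from rfl]
      congr 1
      ring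
    simp only [this, zpow_natCast, div_eq_inv_mul]
    rw [zpow_neg, show (n : ℤ) + 1 = ((n + 1 : ℕ) : ℤ) by push_cast; rfl, zpow_natCast, inv_pow,
      pow_succ z (n + 1)]
    field_simp

lemma qTheta_eq (hx : 1 < x) {z : ℂ} (hz : z ≠ 0) :
    qTheta x z = qE x z + z * qE x z⁻¹ - z - 1 := (hasSum_qTheta hx hz).tsum_eq

lemma qE_inv_mul (hx : 1 < x) {z : ℂ} (hz : z ≠ 0) :
    qE x (x * z)⁻¹ = z * (qE x z⁻¹ - 1) := by
  have hx0 : (x : ℂ) ≠ 0 := by exact_mod_cast (by linarith : x ≠ 0)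
  have h := qE_mul hx (x * z)⁻¹
  rw [show (x : ℂ) * (x * z)⁻¹ = z⁻¹ by field_simp] at h
  rw [h]
  field_simp
  ring

lemma qTheta_mul (hx : 1 < x) {z : ℂ} (hz : z ≠ 0) :
    qTheta x (x * z) = x * z * qTheta x z := by
  have hx0 : (x : ℂ) ≠ 0 := by exact_mod_cast (by linarith : x ≠ 0)
  rw [qTheta_eq hx hz, qTheta_eq hx (mul_ne_zero hx0 hz), qE_mul hx, qE_inv_mul hx hz]
  ring

lemma continuousOn_qTheta (hx : 1 < x) : ContinuousOn (qTheta x) {0}ᶜ := by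
  have : ContinuousOn (fun z => qE x z + z * qE x z⁻¹ - z - 1) {0}ᶜ := by
    have h := continuous_qE hx
    have hinv : ContinuousOn (fun z : ℂ => z⁻¹) {0}ᶜ := continuousOn_inv₀
    have h2 : ContinuousOn (fun z : ℂ => qE x z⁻¹) {0}ᶜ := h.comp_continuousOn hinv
    fun_prop
  exact this.congr fun z hz => qTheta_eq hx hz

lemma qNumber_mul (x : ℝ) (n : ℕ) : qNumber x n * (x - 1) = x ^ n - 1 := geom_sum_mul x n

lemma qNumber_succ_ge (hx : 1 < x) (n : ℕ) : (n : ℝ) + 1 ≤ qNumber x (n + 1) := by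
  unfold qNumber
  calc (n : ℝ) + 1 = ∑ j ∈ Finset.range (n + 1), (1 : ℝ) := by simp
    _ ≤ _ := Finset.sum_le_sum fun j _ => one_le_pow₀ hx.le

lemma qNumber_succ_pos (hx : 1 < x) (n : ℕ) : 0 < qNumber x (n + 1) :=
  lt_of_lt_of_le (by positivity) (qNumber_succ_ge hx n)

lemma qFactorial_succ (x : ℝ) (n : ℕ) :
    qFactorial x (n + 1) = qFactorial x n * qNumber x (n + 1) := Finset.prod_range_succ _ _

lemma qFactorial_zero (x : ℝ) : qFactorial x 0 = 1 := Finset.prod_range_zero _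

lemma qFactorial_pos (hx : 1 < x) (n : ℕ) : 0 < qFactorial x n :=
  Finset.prod_pos fun j _ => qNumber_succ_pos hx j

lemma summable_qExp_norm (hx : 1 < x) (R : ℝ) :
    Summable fun n : ℕ => ‖((qFactorial x n : ℂ))⁻¹‖ * R ^ n := by
  refine summable_of_norm_succ_le (ρ := fun n : ℕ => |R| * (1 / ((n : ℝ) + 1))) (l := |R| * 0)
    (by simp) (tendsto_one_div_add_atTop_nhds_zero_nat.const_mul _) fun n => ?_
  have h1 := qFactorial_pos hx n
  have h2 := qNumber_succ_pos hx n
  simp only [norm_mul, norm_inv, norm_pow, Complex.norm_real, Real.norm_eq_abs,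
    qFactorial_succ, abs_of_pos h1, abs_of_pos h2, mul_inv, pow_succ]
  have : (qNumber x (n + 1))⁻¹ ≤ 1 / ((n : ℝ) + 1) := by
    rw [one_div]; exact inv_anti₀ (by positivity) (qNumber_succ_ge hx n)
  calc _ = |R| * (qNumber x (n + 1))⁻¹ * ((qFactorial x n)⁻¹ * |R| ^ n) := by ring
    _ ≤ _ := by gcongr

lemma hasSum_qExp (hx : 1 < x) (z : ℂ) :
    HasSum (fun n : ℕ => ((qFactorial x n : ℂ))⁻¹ * z ^ n) (qExp x z) := by
  have : Summable (fun n : ℕ => ((qFactorial x n : ℂ))⁻¹ * z ^ n) := by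
    refine Summable.of_norm ?_
    simpa only [norm_mul, norm_pow] using summable_qExp_norm hx ‖z‖
  convert! this.hasSum using 1
  exact tsum_congr fun n => by rw [div_eq_inv_mul]

lemma continuous_qExp (hx : 1 < x) : Continuous (qExp x) := by
  convert! continuous_tsum_powerSeries (summable_qExp_norm hx) using 1
  funext z
  exact (hasSum_qExp hx z).tsum_eq.symm

lemma qExp_zero (hx : 1 < x) : qExp x 0 = 1 := by
  have := (hasSum_qExp hx 0).unique (hasSum_single 0 fun n hn => by simp [hn])
  simpa [qFactorial_zero] using this

lemma qExp_mul (hx : 1 < x) (z : ℂ) : qExp x (x * z) = (1 + (x - 1) * z) * qExp x z := by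
  have h1 := (hasSum_nat_add_iff' 1).2 ((hasSum_qExp hx (x * z)).sub (hasSum_qExp hx z))
  have h2 := (hasSum_qExp hx z).mul_left ((x - 1) * z)
  have := h1.unique (f := fun n : ℕ => (qFactorial x (n + 1) : ℂ)⁻¹ * (x * z) ^ (n + 1) -
    (qFactorial x (n + 1) : ℂ)⁻¹ * z ^ (n + 1)) (a₂ := (x - 1) * z * qExp x z) (by
      convert! h2 using 1
      funext n
      have e1 : (qFactorial x n : ℂ) ≠ 0 := by exact_mod_cast (qFactorial_pos hx n).ne'
      have e2 : (qNumber x (n + 1) : ℂ) ≠ 0 := by exact_mod_cast (qNumber_succ_pos hx n).ne'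
      have e3 : (qNumber x (n + 1) : ℂ) * (x - 1) = x ^ (n + 1) - 1 := by
        exact_mod_cast qNumber_mul x (n + 1)
      rw [qFactorial_succ, mul_pow]
      push_cast
      field_simp
      rw [e3, pow_succ z]
      ring)
  simp at this
  linear_combination this

lemma ofReal_mul_mem_slitPlane {t : ℝ} (ht : 0 < t) {c : ℂ} (hc : c ∈ Complex.slitPlane) :
    (t : ℂ) * c ∈ Complex.slitPlane := by
  rw [Complex.mem_slitPlane_iff] at hc ⊢
  rcases hc with h | h
  · left; simpa using mul_pos ht h
  · right; simpa using ⟨ht.ne', h⟩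

lemma one_add_ne_zero_of_mem_slitPlane {c : ℂ} (hc : c ∈ Complex.slitPlane) : 1 + c ≠ 0 := by
  intro h
  rw [Complex.mem_slitPlane_iff, show c = -1 by linear_combination h] at hc
  norm_num at hc

lemma tendsto_qExp_mul_inv_pow (hx : 1 < x) (z : ℂ) :
    Tendsto (fun N : ℕ => qExp x (((x⁻¹ ^ N : ℝ) : ℂ) * z)) atTop (𝓝 1) := by
  have h1 : Tendsto (fun N : ℕ => ((x⁻¹ ^ N : ℝ) : ℂ) * z) atTop (𝓝 (((0 : ℝ) : ℂ) * z)) :=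
    ((Complex.continuous_ofReal.tendsto _).comp (tendsto_pow_atTop_nhds_zero_of_lt_one
      (by positivity) (inv_lt_one_of_one_lt₀ hx))).mul_const z
  have := ((continuous_qExp hx).tendsto _).comp h1
  simpa [qExp_zero hx, Function.comp_def] using this

/-- A zero at `z` would propagate to every `x⁻ᴺ z`, since the factors in the functional equation do
not vanish off the negative axis. Continuity at `0`, where the value is `1`, forbids this. -/
lemma qExp_ne_zero (hx : 1 < x) {z : ℂ} (hz : z ∈ Complex.slitPlane) : qExp x z ≠ 0 := by
  intro h0
  have hx0 : (x : ℂ) ≠ 0 := by exact_mod_cast (by linarith : x ≠ 0)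
  have key : ∀ N : ℕ, qExp x (((x⁻¹ ^ N : ℝ) : ℂ) * z) = 0 := by
    intro N
    induction N with
    | zero => simpa using h0
    | succ N ih =>
      have hpos : 0 < x⁻¹ ^ (N + 1) := by positivity
      have e := qExp_mul hx (((x⁻¹ ^ (N + 1) : ℝ) : ℂ) * z)
      have e2 : (x : ℂ) * (((x⁻¹ ^ (N + 1) : ℝ) : ℂ) * z) = ((x⁻¹ ^ N : ℝ) : ℂ) * z := by
        push_cast; rw [pow_succ]; field_simp
      rw [e2, ih] at e
      have hne := one_add_ne_zero_of_mem_slitPlane (ofReal_mul_mem_slitPlane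
        (mul_pos (sub_pos.2 hx) hpos) hz)
      rcases mul_eq_zero.1 e.symm with h | h
      · exact absurd h (by push_cast at hne ⊢; rwa [← mul_assoc])
      · exact h
  have := (tendsto_qExp_mul_inv_pow hx z).congr key
  exact one_ne_zero (tendsto_nhds_unique this tendsto_const_nhds)

end Basic

/-! ### Nonvanishing of `Θ_x` off the negative axis, by the Jacobi triple product. -/

section ThetaZeros

variable {x : ℝ}

/-- `∏_{j=1}^n 1 / (1 - x⁻ʲ)`, in terms of `q`-factorials. -/
def eulerCoeff (x : ℝ) (n : ℕ) : ℝ := x ^ (n * (n - 1) / 2 + n) / (qFactorial x n * (x - 1) ^ n)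

lemma eulerCoeff_succ (hx : 1 < x) (n : ℕ) :
    eulerCoeff x (n + 1) = eulerCoeff x n * (1 + 1 / (x ^ (n + 1) - 1)) := by
  have h1 : x ^ (n + 1) - 1 ≠ 0 := (sub_pos.2 (one_lt_pow₀ hx (by simp))).ne'
  have h2 := (qNumber_succ_pos hx n).ne'
  have h3 := (qFactorial_pos hx n).ne'
  have h4 : x - 1 ≠ 0 := (sub_pos.2 hx).ne'
  have h5 := qNumber_mul x (n + 1)
  have h6 : 1 + 1 / (x ^ (n + 1) - 1) = x ^ (n + 1) / (x ^ (n + 1) - 1) := by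
    field_simp; ring
  rw [h6, ← h5, eulerCoeff, eulerCoeff, Nat.triangle_succ, qFactorial_succ]
  field_simp
  ring

/-- These are partial products of `∏ (1 + 1 / (x ^ j - 1))`, which converges absolutely. Below, only
boundedness and the existence of a limit matter, not that the limit is nonzero. -/
lemma exists_tendsto_eulerCoeff (hx : 1 < x) : ∃ a, Tendsto (eulerCoeff x) atTop (𝓝 a) := by
  have hsum : Summable fun n : ℕ => 1 / (x ^ (n + 1) - 1) := by
    have hx0 : 0 < x := by linarith
    refine summable_of_norm_succ_le (ρ := fun _ => x⁻¹) (inv_lt_one_of_one_lt₀ hx)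
      tendsto_const_nhds fun n => ?_
    have h1 : 0 < x ^ (n + 1) - 1 := sub_pos.2 (one_lt_pow₀ hx (by simp))
    have h2 : 0 < x ^ (n + 1 + 1) - 1 := sub_pos.2 (one_lt_pow₀ hx (by simp))
    rw [Real.norm_of_nonneg (by positivity), Real.norm_of_nonneg (by positivity), inv_eq_one_div,
      div_mul_div_comm, one_mul]
    refine one_div_le_one_div_of_le (by positivity) ?_
    rw [pow_succ x (n + 1)]
    nlinarith
  have h := (Real.multipliable_one_add_of_summable hsum).hasProd.tendsto_prod_nat
  refine ⟨_, h.congr fun n => ?_⟩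
  induction n with
  | zero => simp [eulerCoeff, qFactorial_zero]
  | succ n ih => rw [Finset.prod_range_succ, ih, eulerCoeff_succ hx]

lemma int_triangle_add (m N : ℤ) :
    (m + N) * (m + N - 1) / 2 = m * (m - 1) / 2 + N * (N - 1) / 2 + m * N := by
  have h1 : ∀ k : ℤ, k * (k - 1) / 2 * 2 = k * (k - 1) := fun k =>
    Int.ediv_mul_cancel (Int.even_mul_pred_self k).two_dvd
  have a := h1 (m + N)
  have b := h1 m
  have c := h1 N
  nlinarith

/-- The dilated `q`-exponential `z ↦ ∏_{j ≥ 0} (1 + z x⁻ʲ)`. -/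
def qProd (x : ℝ) (z : ℂ) : ℂ := qExp x ((x / (x - 1) : ℝ) * z)

lemma qProd_mul (hx : 1 < x) (z : ℂ) : qProd x (x * z) = (1 + x * z) * qProd x z := by
  have h4 : (x : ℂ) - 1 ≠ 0 := by exact_mod_cast (sub_pos.2 hx).ne'
  rw [qProd, qProd, mul_left_comm, qExp_mul hx]
  push_cast
  field_simp

/-- Pulling the large part `x ^ j * z` out of each factor leaves the same finite product as in
`qProd_inv`, so the two can be combined. -/
lemma qProd_pow_mul (hx : 1 < x) {z : ℂ} (hz : z ≠ 0) (N : ℕ) :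
    qProd x (x ^ N * z) = x ^ (N * (N - 1) / 2 + N) * z ^ N *
      (∏ j ∈ Finset.range N, (1 + (x ^ (j + 1) * z)⁻¹)) * qProd x z := by
  have hx0 : (x : ℂ) ≠ 0 := by exact_mod_cast (by linarith : x ≠ 0)
  induction N with
  | zero => simp
  | succ N ih =>
    rw [pow_succ', mul_assoc, qProd_mul hx, ih, Finset.prod_range_succ, Nat.triangle_succ]
    field_simp
    ring

lemma qProd_inv (hx : 1 < x) {z : ℂ} (hz : z ≠ 0) (N : ℕ) :
    qProd x (x * z)⁻¹ = (∏ j ∈ Finset.range N, (1 + (x ^ (j + 1) * z)⁻¹)) *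
      qProd x (x ^ (N + 1) * z)⁻¹ := by
  have hx0 : (x : ℂ) ≠ 0 := by exact_mod_cast (by linarith : x ≠ 0)
  induction N with
  | zero => simp
  | succ N ih =>
    rw [ih, Finset.prod_range_succ]
    have := qProd_mul hx (x ^ (N + 1 + 1) * z)⁻¹
    rw [show (x : ℂ) * (x ^ (N + 1 + 1) * z)⁻¹ = (x ^ (N + 1) * z)⁻¹ by
      rw [pow_succ' (x : ℂ) (N + 1)]; field_simp] at this
    rw [this, mul_assoc]

lemma summable_norm_qTheta (hx : 1 < x) {z : ℂ} (hz : z ≠ 0) :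
    Summable fun n : ℤ => ‖z ^ n / (x : ℂ) ^ (n * (n - 1) / 2)‖ :=
  (hasSum_qTheta hx hz).summable.norm

/-- Expand `qProd x (x ^ N * z)` in powers, recentre the index by `n = m + N`, and divide by the
prefactor of `qProd_pow_mul`. The `m`-th term becomes `eulerCoeff x (m + N)` times the `m`-th theta
term, and dominated convergence applies because `eulerCoeff x` is bounded. -/
lemma tendsto_prod_mul_qProd (hx : 1 < x) {z : ℂ} (hz : z ≠ 0) {a : ℝ}
    (ha : Tendsto (eulerCoeff x) atTop (𝓝 a)) :
    Tendsto (fun N : ℕ => (∏ j ∈ Finset.range N, (1 + (x ^ (j + 1) * z)⁻¹)) * qProd x z) atTop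
      (𝓝 (a * qTheta x z)) := by
  have hx0 : (x : ℂ) ≠ 0 := by exact_mod_cast (by linarith : x ≠ 0)
  have h4 : (x : ℂ) - 1 ≠ 0 := by exact_mod_cast (sub_pos.2 hx).ne'
  obtain ⟨C, hC⟩ := ha.norm.bddAbove_range
  have hC' : ∀ n, ‖eulerCoeff x n‖ ≤ C := fun n => hC ⟨n, rfl⟩
  -- The recentred series, extended by zero to `m < -N` so that all `N` share the index set `ℤ`.
  set F : ℕ → ℤ → ℂ := fun N m => if 0 ≤ m + N then
    (eulerCoeff x (m + N).toNat : ℂ) * (z ^ m / (x : ℂ) ^ (m * (m - 1) / 2)) else 0 with hF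
  have hlim : Tendsto (fun N => ∑' m, F N m) atTop
      (𝓝 (∑' m : ℤ, (a : ℂ) * (z ^ m / (x : ℂ) ^ (m * (m - 1) / 2)))) := by
    refine tendsto_tsum_of_dominated_convergence
      (bound := fun m : ℤ => C * ‖z ^ m / (x : ℂ) ^ (m * (m - 1) / 2)‖)
      ((summable_norm_qTheta hx hz).mul_left C) (fun m => ?_) (.of_forall fun N m => ?_)
    · have h1 : Tendsto (fun N : ℕ => (m + N).toNat) atTop atTop := by
        refine tendsto_atTop.2 fun b => ?_
        filter_upwards [eventually_ge_atTop (b + m.natAbs)] with N hN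
        omega
      have h2 : Tendsto (fun N : ℕ => (eulerCoeff x (m + N).toNat : ℂ)) atTop (𝓝 (a : ℂ)) :=
        (Complex.continuous_ofReal.tendsto a).comp (ha.comp h1)
      refine (h2.mul_const _).congr' ?_
      filter_upwards [eventually_ge_atTop m.natAbs] with N hN
      rw [hF]
      simp only
      rw [if_pos (by omega)]
    · rw [hF]
      simp only
      split_ifs
      · rw [norm_mul, Complex.norm_real]
        gcongr
        exact hC' _
      · rw [norm_zero]
        exact mul_nonneg ((norm_nonneg _).trans (hC' 0)) (norm_nonneg _)
  rw [tsum_mul_left] at hlim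
  refine hlim.congr fun N => ?_
  have hinj : Function.Injective fun n : ℕ => (n : ℤ) - N := fun a b h => by
    simp only at h; omega
  rw [← hinj.tsum_eq (f := F N) (fun m hm => ?_)]
  · have hne : (x : ℂ) ^ (N * (N - 1) / 2 + N) * z ^ N ≠ 0 := by positivity
    refine mul_left_cancel₀ hne ?_
    rw [← mul_assoc, ← qProd_pow_mul hx hz, qProd, ← (hasSum_qExp hx _).tsum_eq, ← tsum_mul_left]
    refine tsum_congr fun n => ?_
    rw [hF]
    simp only
    rw [if_pos (by omega), show ((n : ℤ) - N + N).toNat = n by omega, eulerCoeff]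
    have e1 : (qFactorial x n : ℂ) ≠ 0 := by exact_mod_cast (qFactorial_pos hx n).ne'
    have h1 : ∀ k : ℕ, ((k * (k - 1) / 2 : ℕ) : ℤ) = (k : ℤ) * ((k : ℤ) - 1) / 2 := fun k => by
      cases k with
      | zero => simp
      | succ k => push_cast; simp
    have e2 : (x : ℂ) ^ (((n : ℤ) - N) * ((n : ℤ) - N - 1) / 2) * x ^ (n * N) =
        x ^ (n * (n - 1) / 2) * x ^ (N * (N - 1) / 2 + N) := by
      rw [← zpow_natCast, ← zpow_natCast, ← zpow_natCast, ← zpow_add₀ hx0, ← zpow_add₀ hx0]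
      congr 1
      have := int_triangle_add ((n : ℤ) - N) N
      rw [sub_add_cancel] at this
      push_cast [h1]
      rw [this]
      have h2 : (N : ℤ) * (N - 1) / 2 * 2 = N * (N - 1) :=
        Int.ediv_mul_cancel (Int.even_mul_pred_self _).two_dvd
      linarith
    have e3 : z ^ ((n : ℤ) - N) * z ^ N = z ^ n := by
      rw [← zpow_natCast, ← zpow_add₀ hz, sub_add_cancel, zpow_natCast]
    have e4 : (x : ℂ) ^ (((n : ℤ) - N) * ((n : ℤ) - N - 1) / 2) ≠ 0 := zpow_ne_zero _ hx0
    push_cast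
    rw [mul_pow, mul_pow, div_pow, ← e3, ← pow_mul, mul_comm N n]
    field_simp
    rw [pow_add (x : ℂ) (n * (n - 1) / 2) n]
    linear_combination -(x : ℂ) ^ n * e2
  · by_contra h
    refine hm ?_
    rw [hF]
    simp only
    rw [if_neg]
    intro h0
    exact h ⟨(m + N).toNat, by simp only; omega⟩

lemma inv_mem_slitPlane {z : ℂ} (hz : z ∈ Complex.slitPlane) : z⁻¹ ∈ Complex.slitPlane := by
  have h0 := Complex.normSq_pos.2 (Complex.slitPlane_ne_zero hz)
  rw [Complex.mem_slitPlane_iff] at hz ⊢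
  rw [Complex.inv_re, Complex.inv_im]
  rcases hz with h | h
  · exact Or.inl (div_pos h h0)
  · exact Or.inr (div_ne_zero (neg_ne_zero.2 h) h0.ne')

/-- The limit in `tendsto_prod_mul_qProd`, multiplied by a factor tending to `1`, is that of the
constant sequence `qProd x (x * z)⁻¹ * qProd x z`. Hence this product equals `a * qTheta x z`, and
neither of its factors vanishes. -/
lemma qTheta_ne_zero (hx : 1 < x) {z : ℂ} (hz : z ∈ Complex.slitPlane) : qTheta x z ≠ 0 := by
  intro h0
  have hx0 : 0 < x := by linarith
  have hz0 := Complex.slitPlane_ne_zero hz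
  have hpos : 0 < x / (x - 1) := div_pos hx0 (sub_pos.2 hx)
  obtain ⟨a, ha⟩ := exists_tendsto_eulerCoeff hx
  have h1 := tendsto_prod_mul_qProd hx hz0 ha
  have h2 : Tendsto (fun N : ℕ => qProd x (x ^ (N + 1) * z)⁻¹) atTop (𝓝 1) := by
    refine ((tendsto_qExp_mul_inv_pow hx ((x / (x - 1) : ℝ) * z⁻¹)).comp
      (tendsto_add_atTop_nat 1)).congr fun N => ?_
    simp only [Function.comp, qProd]
    congr 1
    push_cast
    rw [mul_inv]
    ring
  have h3 := h1.mul h2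
  rw [h0, mul_zero, zero_mul] at h3
  have h4 := tendsto_nhds_unique (h3.congr fun N => show _ = qProd x (x * z)⁻¹ * qProd x z by
    rw [qProd_inv hx hz0 N]; ring) tendsto_const_nhds
  refine mul_ne_zero ?_ ?_ h4.symm
  · exact qExp_ne_zero hx (ofReal_mul_mem_slitPlane hpos
      (inv_mem_slitPlane (ofReal_mul_mem_slitPlane hx0 hz)))
  · exact qExp_ne_zero hx (ofReal_mul_mem_slitPlane hpos hz)

end ThetaZeros

/-! ### Lower bounds on rays and moments of `1 / Θ_x` and `1 / exp_x`. -/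

/-- The moment `∫_0^∞ t ^ n / D(tc) dt`. -/
def moment (D : ℂ → ℂ) (c : ℂ) (n : ℕ) : ℂ := ∫ t in Ioi (0 : ℝ), (t : ℂ) ^ n / D (t * c)

/-- The absolute moment `∫_0^∞ |t ^ n / D(tc)| dt`. -/
def absMoment (D : ℂ → ℂ) (c : ℂ) (n : ℕ) : ℝ := ∫ t in Ioi (0 : ℝ), ‖(t : ℂ) ^ n / D (t * c)‖

lemma integrableOn_pow_div_of_lower_bound {h : ℝ → ℂ} (hcont : ContinuousOn h (Ioi 0))
    (hlow : ∀ N : ℕ, ∃ k, 0 < k ∧ ∀ t : ℝ, 0 < t → k * t ^ N ≤ ‖h t‖) (n : ℕ) :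
    IntegrableOn (fun t : ℝ => (t : ℂ) ^ n / h t) (Ioi 0) := by
  obtain ⟨k₁, hk₁, h₁⟩ := hlow n
  -- The exponents `n` and `n + 2` together bound `t ^ n * (1 + t ^ 2)`, giving the majorant `1 / (1
  -- + t ^ 2)`.
  obtain ⟨k₂, hk₂, h₂⟩ := hlow (n + 2)
  have hpos : ∀ t : ℝ, 0 < t → 0 < ‖h t‖ := fun t ht => lt_of_lt_of_le (by positivity) (h₁ t ht)
  have hmeas : AEStronglyMeasurable (fun t : ℝ => (t : ℂ) ^ n / h t) (volume.restrict (Ioi 0)) := by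
    refine ContinuousOn.aestronglyMeasurable (ContinuousOn.div (by fun_prop) hcont fun t ht => ?_)
      measurableSet_Ioi
    exact norm_pos_iff.1 (hpos t ht)
  refine ((integrable_inv_one_add_sq.const_mul (k₁⁻¹ + k₂⁻¹)).integrableOn).mono' hmeas ?_
  refine (ae_restrict_iff' measurableSet_Ioi).2 (.of_forall fun t ht => ?_)
  have ht' : (0 : ℝ) < t := ht
  rw [norm_div, norm_pow, Complex.norm_real, Real.norm_of_nonneg ht'.le, div_le_iff₀ (hpos t ht'),
    ← div_eq_mul_inv, div_mul_eq_mul_div, le_div_iff₀ (by positivity)]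
  have e1 : t ^ n ≤ k₁⁻¹ * ‖h t‖ := by
    rw [← div_eq_inv_mul, le_div_iff₀ hk₁, mul_comm]; exact h₁ t ht'
  have e2 : t ^ (n + 2) ≤ k₂⁻¹ * ‖h t‖ := by
    rw [← div_eq_inv_mul, le_div_iff₀ hk₂, mul_comm]; exact h₂ t ht'
  calc t ^ n * (1 + t ^ 2) = t ^ n + t ^ (n + 2) := by ring
    _ ≤ _ := by linarith

section Moments

variable {x : ℝ} {c : ℂ}

lemma continuousOn_qTheta_ray (hx : 1 < x) (hc : c ∈ Complex.slitPlane) :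
    ContinuousOn (fun t : ℝ => qTheta x (t * c)) (Ioi 0) := by
  refine (continuousOn_qTheta hx).comp (by fun_prop) fun t ht => ?_
  exact Complex.slitPlane_ne_zero (ofReal_mul_mem_slitPlane ht hc)

lemma qTheta_mul_ray (hx : 1 < x) (hc : c ∈ Complex.slitPlane) {t : ℝ} (ht : 0 < t) :
    qTheta x ((x * t : ℝ) * c) = x * (t * c) * qTheta x (t * c) := by
  rw [← qTheta_mul hx (Complex.slitPlane_ne_zero (ofReal_mul_mem_slitPlane ht hc))]
  push_cast
  rw [mul_assoc]

/-- For `g t = ‖Θ(tc)‖ / t ^ N`, the dilation `t ↦ xt` multiplies `g` by `x t ‖c‖ / x ^ N`. This is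
at least `1` for large `t` and at most `1` for small `t`, so `g` does not decrease towards either
end. -/
lemma qTheta_lower_bound (hx : 1 < x) (hc : c ∈ Complex.slitPlane) (N : ℕ) :
    ∃ k, 0 < k ∧ ∀ t : ℝ, 0 < t → k * t ^ N ≤ ‖qTheta x (t * c)‖ := by
  have hx0 : 0 < x := by linarith
  have hc0 : 0 < ‖c‖ := norm_pos_iff.2 (Complex.slitPlane_ne_zero hc)
  set g : ℝ → ℝ := fun t => ‖qTheta x (t * c)‖ / t ^ N with hg
  have hgc : ContinuousOn g (Ioi 0) := by
    refine (continuousOn_qTheta_ray hx hc).norm.div (by fun_prop) fun t ht => ?_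
    have : (0 : ℝ) < t := ht
    positivity
  have hgpos : ∀ t, 0 < t → 0 < g t := fun t ht =>
    div_pos (norm_pos_iff.2 (qTheta_ne_zero hx (ofReal_mul_mem_slitPlane ht hc))) (by positivity)
  have hgx : ∀ t, 0 < t → g (x * t) = x * t * ‖c‖ / x ^ N * g t := fun t ht => by
    simp only [hg]
    rw [qTheta_mul_ray hx hc ht]
    simp only [norm_mul, Complex.norm_real, Real.norm_of_nonneg ht.le, Real.norm_of_nonneg hx0.le]
    rw [mul_pow]
    field_simp
  obtain ⟨k₁, hk₁, h₁⟩ := exists_pos_le_of_le_comp_mul hx (T := x ^ N / ‖c‖) (by positivity) hgc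
    hgpos (fun t ht => by
      have ht0 : 0 < t := lt_of_lt_of_le (by positivity) ht
      rw [hgx t ht0]
      refine le_mul_of_one_le_left (hgpos t ht0).le ?_
      rw [one_le_div (by positivity)]
      rw [div_le_iff₀ hc0] at ht
      nlinarith [mul_pos ht0 hc0]) one_pos
  obtain ⟨k₂, hk₂, h₂⟩ := exists_pos_le_of_le_comp_mul hx (T := ‖c‖) (g := fun t => g t⁻¹) hc0
    (hgc.comp (continuousOn_inv₀.mono fun t (ht : 0 < t) => ht.ne') fun t ht => mem_Ioi.2 (inv_pos.2 (mem_Ioi.1 ht)))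
    (fun t ht => hgpos _ (inv_pos.2 ht)) (fun t ht => by
      have ht0 : 0 < t := hc0.trans_le ht
      have := hgx (x * t)⁻¹ (by positivity)
      rw [show x * (x * t)⁻¹ = t⁻¹ by field_simp] at this
      rw [this]
      refine mul_le_of_le_one_left (hgpos _ (by positivity)).le ?_
      rw [div_le_one (by positivity), inv_mul_le_iff₀ ht0]
      exact ht.trans (le_mul_of_one_le_right ht0.le (one_le_pow₀ hx.le))) one_pos
  refine ⟨min k₁ k₂, lt_min hk₁ hk₂, fun t ht => ?_⟩
  have hle : min k₁ k₂ ≤ g t := by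
    rcases le_total 1 t with h | h
    · exact (min_le_left _ _).trans (h₁ t h)
    · have := h₂ t⁻¹ ((one_le_inv₀ ht).2 h)
      simp only [inv_inv] at this
      exact (min_le_right _ _).trans this
  rwa [hg, le_div_iff₀ (by positivity)] at hle

lemma integrableOn_qTheta (hx : 1 < x) (hc : c ∈ Complex.slitPlane) (n : ℕ) :
    IntegrableOn (fun t : ℝ => (t : ℂ) ^ n / qTheta x (t * c)) (Ioi 0) :=
  integrableOn_pow_div_of_lower_bound (continuousOn_qTheta_ray hx hc)
    (qTheta_lower_bound hx hc) n

lemma qTheta_integrand_mul (hx : 1 < x) (hc : c ∈ Complex.slitPlane) (n : ℕ) {t : ℝ} (ht : 0 < t) :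
    ((x * t : ℝ) : ℂ) ^ (n + 1) / qTheta x ((x * t : ℝ) * c) =
      x ^ n / c * ((t : ℂ) ^ n / qTheta x (t * c)) := by
  have hx0 : (x : ℂ) ≠ 0 := by exact_mod_cast (by linarith : x ≠ 0)
  have ht0 : (t : ℂ) ≠ 0 := by exact_mod_cast ht.ne'
  have hc0 := Complex.slitPlane_ne_zero hc
  have h0 := qTheta_ne_zero hx (ofReal_mul_mem_slitPlane ht hc)
  rw [qTheta_mul_ray hx hc ht]
  push_cast
  field_simp
  ring

lemma moment_qTheta_succ (hx : 1 < x) (hc : c ∈ Complex.slitPlane) (n : ℕ) :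
    c * moment (qTheta x) c (n + 1) = x ^ (n + 1) * moment (qTheta x) c n := by
  have hx0 : 0 < x := by linarith
  have hc0 := Complex.slitPlane_ne_zero hc
  have h := integral_comp_mul_left_Ioi' (fun t : ℝ => (t : ℂ) ^ (n + 1) / qTheta x (t * c)) 0 hx0
  rw [mul_zero, setIntegral_congr_fun measurableSet_Ioi
    (fun t ht => qTheta_integrand_mul hx hc n ht), integral_const_mul] at h
  change x • (_ * moment (qTheta x) c n) = moment (qTheta x) c (n + 1) at h
  rw [← h, Complex.real_smul]
  field_simp
  ring

lemma absMoment_qTheta_succ (hx : 1 < x) (hc : c ∈ Complex.slitPlane) (n : ℕ) :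
    ‖c‖ * absMoment (qTheta x) c (n + 1) = x ^ (n + 1) * absMoment (qTheta x) c n := by
  have hx0 : 0 < x := by linarith
  have hc0 : ‖c‖ ≠ 0 := norm_ne_zero_iff.2 (Complex.slitPlane_ne_zero hc)
  have h := integral_comp_mul_left_Ioi'
    (fun t : ℝ => ‖(t : ℂ) ^ (n + 1) / qTheta x (t * c)‖) 0 hx0
  rw [mul_zero, setIntegral_congr_fun (g := fun t : ℝ => ‖(x : ℂ) ^ n / c‖ *
    ‖(t : ℂ) ^ n / qTheta x (t * c)‖) measurableSet_Ioi
    (fun t ht => by simp only; rw [qTheta_integrand_mul hx hc n ht, norm_mul]),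
    integral_const_mul] at h
  change x • (_ * absMoment (qTheta x) c n) = absMoment (qTheta x) c (n + 1) at h
  rw [← h, norm_div, norm_pow, Complex.norm_real, Real.norm_of_nonneg hx0.le, smul_eq_mul]
  field_simp
  ring

lemma tendsto_ofReal_mul_nhdsGT (c : ℂ) :
    Tendsto (fun t : ℝ => (t : ℂ) * c) (𝓝[>] 0) (𝓝 0) := by
  have : Continuous fun t : ℝ => (t : ℂ) * c := by fun_prop
  simpa using (this.tendsto 0).mono_left nhdsWithin_le_nhds

/-- Frullani for `f t = u E(u⁻¹) / Θ(u)` with `u = tc`. The equations for `E` and `Θ` give `f t - f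
(xt) = u / Θ(u)`, and `f` tends to `1` at `0` and to `0` at infinity. -/
lemma moment_qTheta_zero (hx : 1 < x) (hc : c ∈ Complex.slitPlane) :
    c * moment (qTheta x) c 0 = Real.log x := by
  have hx0 : 0 < x := by linarith
  have hc0 := Complex.slitPlane_ne_zero hc
  have hne : ∀ t : ℝ, 0 < t → (t : ℂ) * c ≠ 0 := fun t ht =>
    Complex.slitPlane_ne_zero (ofReal_mul_mem_slitPlane ht hc)
  have hth : ∀ t : ℝ, 0 < t → qTheta x (t * c) ≠ 0 := fun t ht =>
    qTheta_ne_zero hx (ofReal_mul_mem_slitPlane ht hc)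
  set f : ℝ → ℂ := fun t => t * c * qE x (t * c)⁻¹ / qTheta x (t * c) with hf
  have hinv : ContinuousOn (fun t : ℝ => ((t : ℂ) * c)⁻¹) (Ioi 0) :=
    ContinuousOn.inv₀ (by fun_prop) fun t ht => hne t ht
  have hfc : ContinuousOn f (Ioi 0) := by
    refine ContinuousOn.div (ContinuousOn.mul (by fun_prop) ?_) (continuousOn_qTheta_ray hx hc)
      fun t ht => hth t ht
    exact (continuous_qE hx).comp_continuousOn hinv
  have hint : ∀ t : ℝ, 0 < t → t⁻¹ • (f (1 * t) - f (x * t)) =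
      c * ((t : ℂ) ^ 0 / qTheta x (t * c)) := fun t ht => by
    have h1 := hne t ht
    have h2 := hth t ht
    have ht0 : (t : ℂ) ≠ 0 := by exact_mod_cast ht.ne'
    have hxC : (x : ℂ) ≠ 0 := by exact_mod_cast hx0.ne'
    simp only [hf, one_mul]
    rw [qTheta_mul_ray hx hc ht, Complex.real_smul]
    push_cast
    rw [mul_assoc (x : ℂ), qE_inv_mul hx h1]
    field_simp
    ring
  have hL : Tendsto f (𝓝[>] 0) (𝓝 1) := by
    -- This is the numerator of `1 - f t`; `Θ` is bounded below on the ray.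
    have h1 : Tendsto (fun t : ℝ => qE x (t * c) - t * c - 1) (𝓝[>] 0) (𝓝 0) := by
      have : Continuous fun z => qE x z - z - 1 := by
        have := continuous_qE hx; fun_prop
      simpa [qE_zero hx, Function.comp_def] using
        (this.tendsto 0).comp (tendsto_ofReal_mul_nhdsGT c)
    obtain ⟨k, hk, hlow⟩ := qTheta_lower_bound hx hc 0
    have h2 : Tendsto (fun t : ℝ => (qE x (t * c) - t * c - 1) / qTheta x (t * c)) (𝓝[>] 0)
        (𝓝 0) := by
      refine squeeze_zero_norm' (a := fun t : ℝ => ‖qE x (t * c) - t * c - 1‖ / k) ?_ ?_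
      · filter_upwards [self_mem_nhdsWithin] with t ht
        rw [norm_div]
        exact div_le_div_of_nonneg_left (norm_nonneg _) hk (by simpa using hlow t ht)
      · simpa using h1.norm.div_const k
    have h3 := h2.const_sub 1
    rw [sub_zero] at h3
    refine h3.congr' ?_
    filter_upwards [self_mem_nhdsWithin] with t ht
    have h4 := hth t ht
    simp only [hf]
    rw [eq_div_iff h4, sub_mul, div_mul_cancel₀ _ h4, qTheta_eq hx (hne t ht)]
    ring
  have hR : Tendsto f atTop (𝓝 0) := by
    obtain ⟨k, hk, hlow⟩ := qTheta_lower_bound hx hc 2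
    have h0 : Tendsto (fun t : ℝ => ((t⁻¹ : ℝ) : ℂ) * c⁻¹) atTop (𝓝 0) := by
      have h := (Complex.continuous_ofReal.tendsto 0).comp (tendsto_inv_atTop_zero (𝕜 := ℝ))
      simpa [Function.comp_def] using h.mul_const c⁻¹
    have h1 : Tendsto (fun t : ℝ => ‖c * qE x (t * c)⁻¹‖ * (t⁻¹ / k)) atTop
        (𝓝 (‖c * qE x 0‖ * (0 / k))) := by
      refine Tendsto.mul ?_ (tendsto_inv_atTop_zero.div_const k)
      have := (((continuous_qE hx).tendsto 0).comp h0).const_mul c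
      refine this.norm.congr fun t => ?_
      simp only [Function.comp, mul_inv]
      push_cast
      rfl
    rw [zero_div, mul_zero] at h1
    refine squeeze_zero_norm' ?_ h1
    filter_upwards [eventually_gt_atTop 0] with t ht
    have h4 := hth t ht
    simp only [hf]
    rw [norm_div, div_le_iff₀ (norm_pos_iff.2 h4), mul_assoc (t : ℂ), norm_mul, Complex.norm_real,
      Real.norm_of_nonneg ht.le]
    calc t * ‖c * qE x (t * c)⁻¹‖ = ‖c * qE x (t * c)⁻¹‖ * (t⁻¹ / k) * (k * t ^ 2) := by
          field_simp
      _ ≤ _ := by gcongr; exact hlow t ht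
  have hi : IntegrableOn (fun t : ℝ => c * ((t : ℂ) ^ 0 / qTheta x (t * c))) (Ioi 0) :=
    (integrableOn_qTheta hx hc 0).const_mul c
  have h := Frullani.integral_Ioi_eq (hfc.locallyIntegrableOn measurableSet_Ioi) one_pos hx0 hL hR
    (hi.congr_fun (fun t ht => (hint t ht).symm) measurableSet_Ioi)
  rw [setIntegral_congr_fun measurableSet_Ioi (fun t ht => hint t ht), integral_const_mul] at h
  rw [moment, h]
  simp

lemma moment_qTheta (hx : 1 < x) (hc : c ∈ Complex.slitPlane) (n : ℕ) :
    c ^ (n + 1) * moment (qTheta x) c n = x ^ (n * (n - 1) / 2 + n) * Real.log x := by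
  induction n with
  | zero => simpa using moment_qTheta_zero hx hc
  | succ n ih =>
    rw [pow_succ c, mul_assoc, moment_qTheta_succ hx hc, mul_left_comm, ih, Nat.triangle_succ]
    ring

lemma qExp_mul_ray (hx : 1 < x) (t : ℝ) :
    qExp x ((x * t : ℝ) * c) = (1 + (x - 1) * (t * c)) * qExp x (t * c) := by
  rw [← qExp_mul hx]
  push_cast
  rw [mul_assoc]

lemma qExp_lower_bound (hx : 1 < x) (hc : c ∈ Complex.slitPlane) (N : ℕ) :
    ∃ k, 0 < k ∧ ∀ t : ℝ, 0 < t → k * t ^ N ≤ ‖qExp x (t * c)‖ := by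
  have hx0 : 0 < x := by linarith
  have hx1 : 0 < x - 1 := by linarith
  have hc0 : 0 < ‖c‖ := norm_pos_iff.2 (Complex.slitPlane_ne_zero hc)
  have hcont : Continuous fun t : ℝ => ‖qExp x (t * c)‖ := by
    have := continuous_qExp hx; fun_prop
  have hpos : ∀ t : ℝ, 0 < t → 0 < ‖qExp x (t * c)‖ := fun t ht =>
    norm_pos_iff.2 (qExp_ne_zero hx (ofReal_mul_mem_slitPlane ht hc))
  -- This `T` makes `‖1 + (x - 1) t c‖ ≥ (x - 1) t ‖c‖ - 1 ≥ x ^ N`. Near `0` compactness of `[0,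
  -- 1]` suffices.
  obtain ⟨k₁, hk₁, h₁⟩ := exists_pos_le_of_le_comp_mul hx
    (g := fun t => ‖qExp x (t * c)‖ / t ^ N)
    (T := (x ^ N + 1) / ((x - 1) * ‖c‖)) (by positivity)
    (hcont.continuousOn.div (by fun_prop) fun t (ht : 0 < t) => by positivity)
    (fun t ht => div_pos (hpos t ht) (by positivity))
    (fun t ht => by
      have ht0 : 0 < t := lt_of_lt_of_le (by positivity) ht
      rw [qExp_mul_ray hx, norm_mul, mul_pow, mul_div_mul_comm]
      refine le_mul_of_one_le_left (div_pos (hpos t ht0) (by positivity)).le ?_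
      rw [one_le_div (by positivity)]
      rw [div_le_iff₀ (by positivity)] at ht
      have h2 : ‖((x : ℂ) - 1) * (t * c)‖ = t * ((x - 1) * ‖c‖) := by
        rw [norm_mul, norm_mul, Complex.norm_real, Real.norm_of_nonneg ht0.le,
          show (x : ℂ) - 1 = ((x - 1 : ℝ) : ℂ) by push_cast; rfl, Complex.norm_real,
          Real.norm_of_nonneg hx1.le]
        ring
      have h3 := norm_sub_norm_le (((x : ℂ) - 1) * (t * c)) (-1)
      rw [sub_neg_eq_add, norm_neg, norm_one, h2, add_comm _ (1 : ℂ)] at h3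
      linarith) one_pos
  obtain ⟨s, hs, hmin⟩ := (isCompact_Icc (a := (0 : ℝ)) (b := 1)).exists_isMinOn
    ⟨0, by simp⟩ hcont.continuousOn
  have hk₂ : 0 < ‖qExp x (s * c)‖ := by
    rcases hs.1.eq_or_lt with h | h
    · simp [← h, qExp_zero hx]
    · exact hpos s h
  refine ⟨min k₁ ‖qExp x (s * c)‖, lt_min hk₁ hk₂, fun t ht => ?_⟩
  rcases le_total 1 t with h | h
  · have := h₁ t h
    rw [le_div_iff₀ (by positivity)] at this
    exact (mul_le_mul_of_nonneg_right (min_le_left _ _) (by positivity)).trans this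
  · calc _ ≤ ‖qExp x (s * c)‖ * 1 := by
          gcongr
          · exact min_le_right _ _
          · exact pow_le_one₀ ht.le h
      _ ≤ _ := by rw [mul_one]; exact hmin ⟨ht.le, h⟩

lemma integrableOn_qExp (hx : 1 < x) (hc : c ∈ Complex.slitPlane) (n : ℕ) :
    IntegrableOn (fun t : ℝ => (t : ℂ) ^ n / qExp x (t * c)) (Ioi 0) :=
  integrableOn_pow_div_of_lower_bound
    (by have := continuous_qExp hx; fun_prop) (qExp_lower_bound hx hc) n

/-- Everything on the right depends on `xt` only, so substitution yields a linear relation between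
the moments `n` and `n + 1`. -/
lemma qExp_integrand_eq (hx : 1 < x) (hc : c ∈ Complex.slitPlane) (n : ℕ) {t : ℝ} (ht : 0 < t) :
    (t : ℂ) ^ n / qExp x (t * c) =
      (x ^ n : ℂ)⁻¹ * (((x * t : ℝ) : ℂ) ^ n / qExp x ((x * t : ℝ) * c)) +
      (x - 1) * c / x ^ (n + 1) * (((x * t : ℝ) : ℂ) ^ (n + 1) / qExp x ((x * t : ℝ) * c)) := by
  have hx0 : (x : ℂ) ≠ 0 := by exact_mod_cast (by linarith : x ≠ 0)
  have h0 := qExp_ne_zero hx (ofReal_mul_mem_slitPlane ht hc)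
  have h1 : 1 + ((x : ℂ) - 1) * (t * c) ≠ 0 := by
    have := one_add_ne_zero_of_mem_slitPlane
      (ofReal_mul_mem_slitPlane (mul_pos (sub_pos.2 hx) ht) hc)
    push_cast at this
    rwa [mul_assoc] at this
  rw [qExp_mul_ray hx]
  push_cast
  generalize qExp x (t * c) = w at *
  generalize hd : 1 + ((x : ℂ) - 1) * (t * c) = d at *
  field_simp
  rw [← hd]
  ring

lemma moment_qExp_succ (hx : 1 < x) (hc : c ∈ Complex.slitPlane) (n : ℕ) :
    c * moment (qExp x) c (n + 1) = x * qNumber x (n + 1) * moment (qExp x) c n := by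
  have hx0 : 0 < x := by linarith
  have hxC : (x : ℂ) ≠ 0 := by exact_mod_cast hx0.ne'
  have h4 : (x : ℂ) - 1 ≠ 0 := by exact_mod_cast (sub_pos.2 hx).ne'
  have e3 : (qNumber x (n + 1) : ℂ) * (x - 1) = x ^ (n + 1) - 1 := by
    exact_mod_cast qNumber_mul x (n + 1)
  have i1 := (integrableOn_qExp hx hc n).const_mul (x ^ n : ℂ)⁻¹
  have i2 := (integrableOn_qExp hx hc (n + 1)).const_mul ((x - 1) * c / x ^ (n + 1) : ℂ)
  have h := integral_comp_mul_left_Ioi' (fun t : ℝ =>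
    (x ^ n : ℂ)⁻¹ * ((t : ℂ) ^ n / qExp x (t * c)) +
      (x - 1) * c / x ^ (n + 1) * ((t : ℂ) ^ (n + 1) / qExp x (t * c))) 0 hx0
  rw [mul_zero, setIntegral_congr_fun measurableSet_Ioi
    (fun t ht => (qExp_integrand_eq hx hc n ht).symm), integral_add i1 i2, integral_const_mul,
    integral_const_mul, Complex.real_smul] at h
  change x * moment (qExp x) c n = _ * moment (qExp x) c n + _ * moment (qExp x) c (n + 1) at h
  field_simp at h
  refine mul_left_cancel₀ h4 ?_
  refine mul_left_cancel₀ (pow_ne_zero n hxC) ?_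
  rw [show ((x : ℂ) - 1) * (x * qNumber x (n + 1) * moment (qExp x) c n) =
    x * (qNumber x (n + 1) * (x - 1)) * moment (qExp x) c n by ring, e3]
  linear_combination -h

/-- The reverse triangle inequality replaces the exact relation. It costs `x ^ (n + 1) + 1` in place
of `x ^ (n + 1) - 1`, which does not change the limiting ratio. -/
lemma absMoment_qExp_succ_le (hx : 1 < x) (hc : c ∈ Complex.slitPlane) (n : ℕ) :
    (x - 1) * ‖c‖ * absMoment (qExp x) c (n + 1) ≤
      x * (x ^ (n + 1) + 1) * absMoment (qExp x) c n := by
  have hx0 : 0 < x := by linarith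
  have hx1 : 0 < x - 1 := by linarith
  have i1 := (integrableOn_qExp hx hc n).const_mul (x ^ n : ℂ)⁻¹
  have i2 := (integrableOn_qExp hx hc (n + 1)).const_mul ((x - 1) * c / x ^ (n + 1) : ℂ)
  have h := integral_comp_mul_left_Ioi' (fun t : ℝ =>
    ‖(x ^ n : ℂ)⁻¹ * ((t : ℂ) ^ n / qExp x (t * c)) +
      (x - 1) * c / x ^ (n + 1) * ((t : ℂ) ^ (n + 1) / qExp x (t * c))‖) 0 hx0
  rw [mul_zero, setIntegral_congr_fun measurableSet_Ioi
    (fun t ht => congrArg norm (qExp_integrand_eq hx hc n ht).symm)] at h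
  have hmono := setIntegral_mono_on (μ := volume) (s := Ioi (0 : ℝ)) (i2.norm.sub i1.norm)
    (i1.add i2).norm measurableSet_Ioi (fun t _ => by
      simp only [Pi.sub_apply, Pi.add_apply]
      have := norm_sub_norm_le ((x - 1) * c / x ^ (n + 1) * ((t : ℂ) ^ (n + 1) / qExp x (t * c)))
        (-((x ^ n : ℂ)⁻¹ * ((t : ℂ) ^ n / qExp x (t * c))))
      rw [norm_neg, sub_neg_eq_add, add_comm (((x : ℂ) - 1) * c / x ^ (n + 1) * _)] at this
      exact this)
  simp only [Pi.sub_apply, Pi.add_apply] at hmono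
  rw [← h, integral_sub i2.norm i1.norm] at hmono
  simp only [norm_mul _ ((_ : ℂ) / _), integral_const_mul, smul_eq_mul] at hmono
  change _ * absMoment (qExp x) c (n + 1) - _ * absMoment (qExp x) c n ≤
    x * absMoment (qExp x) c n at hmono
  rw [show (x : ℂ) - 1 = ((x - 1 : ℝ) : ℂ) by push_cast; rfl] at hmono
  simp only [norm_mul, norm_div, norm_inv, norm_pow, Complex.norm_real,
    Real.norm_of_nonneg hx0.le, Real.norm_of_nonneg hx1.le] at hmono
  have := mul_le_mul_of_nonneg_left hmono (pow_pos hx0 (n + 1)).le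
  calc _ = x ^ (n + 1) * ((x - 1) * ‖c‖ / x ^ (n + 1) * absMoment (qExp x) c (n + 1) -
        (x ^ n)⁻¹ * absMoment (qExp x) c n) + x * absMoment (qExp x) c n := by
        field_simp
        ring
    _ ≤ _ := by linarith

/-- Frullani for `f t = 1 / exp(tc)`, where `f t - f (xt) = (x - 1) t c / exp(xtc)`. -/
lemma moment_qExp_zero (hx : 1 < x) (hc : c ∈ Complex.slitPlane) :
    c * moment (qExp x) c 0 = x * Real.log x / (x - 1) := by
  have hx0 : 0 < x := by linarith
  have hxC : (x : ℂ) ≠ 0 := by exact_mod_cast hx0.ne'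
  have h4 : (x : ℂ) - 1 ≠ 0 := by exact_mod_cast (sub_pos.2 hx).ne'
  have hc0 := Complex.slitPlane_ne_zero hc
  have hth : ∀ t : ℝ, 0 < t → qExp x (t * c) ≠ 0 := fun t ht =>
    qExp_ne_zero hx (ofReal_mul_mem_slitPlane ht hc)
  set f : ℝ → ℂ := fun t => 1 / qExp x (t * c) with hf
  have hfc : ContinuousOn f (Ioi 0) := by
    have := continuous_qExp hx
    exact ContinuousOn.div (by fun_prop) (by fun_prop) fun t ht => hth t ht
  have hint : ∀ t : ℝ, 0 < t → t⁻¹ • (f (1 * t) - f (x * t)) =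
      (x - 1) * c * (((x * t : ℝ) : ℂ) ^ 0 / qExp x ((x * t : ℝ) * c)) := fun t ht => by
    have h2 := hth t ht
    have ht0 : (t : ℂ) ≠ 0 := by exact_mod_cast ht.ne'
    have h1 : 1 + ((x : ℂ) - 1) * (t * c) ≠ 0 := by
      have := one_add_ne_zero_of_mem_slitPlane
        (ofReal_mul_mem_slitPlane (mul_pos (sub_pos.2 hx) ht) hc)
      push_cast at this
      rwa [mul_assoc] at this
    simp only [hf, one_mul]
    rw [qExp_mul_ray hx, Complex.real_smul]
    push_cast
    generalize qExp x (t * c) = w at *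
    generalize hd : 1 + ((x : ℂ) - 1) * (t * c) = d at *
    field_simp
    rw [← hd]
    ring
  have hL : Tendsto f (𝓝[>] 0) (𝓝 1) := by
    have := ((continuous_qExp hx).tendsto 0).comp (tendsto_ofReal_mul_nhdsGT c)
    rw [qExp_zero hx] at this
    simpa [hf, Function.comp_def] using this.inv₀ one_ne_zero
  have hR : Tendsto f atTop (𝓝 0) := by
    obtain ⟨k, hk, hlow⟩ := qExp_lower_bound hx hc 1
    have h1 : Tendsto (fun t : ℝ => k⁻¹ * t⁻¹) atTop (𝓝 (k⁻¹ * 0)) :=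
      tendsto_inv_atTop_zero.const_mul _
    rw [mul_zero] at h1
    refine squeeze_zero_norm' ?_ h1
    filter_upwards [eventually_gt_atTop 0] with t ht
    have h2 := hlow t ht
    rw [pow_one] at h2
    simp only [hf, norm_div, norm_one]
    rw [← mul_inv, one_div]
    exact inv_anti₀ (by positivity) h2
  have hi : IntegrableOn (fun t : ℝ => ((x * t : ℝ) : ℂ) ^ 0 / qExp x ((x * t : ℝ) * c))
      (Ioi 0) := by
    refine (integrableOn_Ioi_comp_mul_left_iff
      (fun t : ℝ => (t : ℂ) ^ 0 / qExp x (t * c)) 0 hx0).2 ?_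
    rw [mul_zero]
    exact integrableOn_qExp hx hc 0
  have hi' : IntegrableOn (fun t : ℝ => ((x : ℂ) - 1) * c *
      (((x * t : ℝ) : ℂ) ^ 0 / qExp x ((x * t : ℝ) * c))) (Ioi 0) := hi.const_mul ((x - 1) * c)
  have h := Frullani.integral_Ioi_eq (hfc.locallyIntegrableOn measurableSet_Ioi) one_pos hx0 hL hR
    (hi'.congr_fun (fun t ht => (hint t ht).symm) measurableSet_Ioi)
  rw [setIntegral_congr_fun measurableSet_Ioi (fun t ht => hint t ht), integral_const_mul,
    integral_comp_mul_left_Ioi (fun t : ℝ => (t : ℂ) ^ 0 / qExp x (t * c)) 0 hx0, mul_zero] at h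
  change _ * (_ • moment (qExp x) c 0) = _ at h
  rw [Complex.real_smul, Complex.real_smul, sub_zero, mul_one, div_one] at h
  rw [← h]
  push_cast
  field_simp

lemma moment_qExp (hx : 1 < x) (hc : c ∈ Complex.slitPlane) (n : ℕ) :
    c ^ (n + 1) * moment (qExp x) c n =
      x ^ n * qFactorial x n * (x * Real.log x / (x - 1)) := by
  induction n with
  | zero => simpa [qFactorial_zero] using moment_qExp_zero hx hc
  | succ n ih =>
    rw [pow_succ c, mul_assoc, moment_qExp_succ hx hc, mul_left_comm, ih, qFactorial_succ]
    push_cast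
    ring

end Moments

/-! ### Action of the operator on power series. -/

section PowerSeries

variable {p q : ℝ}

/-- The `(p,q)`-number `(p ^ n - q ^ n) / (p - q)`. -/
def pqNumber (p q : ℝ) (n : ℕ) : ℝ := ∑ i ∈ Finset.range n, p ^ i * q ^ (n - 1 - i)

lemma pqNumber_mul (p q : ℝ) (n : ℕ) : pqNumber p q n * (p - q) = p ^ n - q ^ n :=
  geom_sum₂_mul p q n

lemma pqNumber_one (p q : ℝ) : pqNumber p q 1 = 1 := by simp [pqNumber]

lemma hasSum_pqDeriv (hp : 0 ≤ p) (hpq : p < q) {g : ℂ → ℂ} {b : ℕ → ℂ} {ρ : ℝ} (hρ : 0 < ρ)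
    (hg : ∀ w : ℂ, ‖w‖ < ρ → HasSum (fun n => b n * w ^ n) (g w)) {z : ℂ} (hz : q * ‖z‖ < ρ) :
    HasSum (fun n => b (n + 1) * pqNumber p q (n + 1) * z ^ n) (pqDeriv p q g z) := by
  have hq : 0 < q := hp.trans_lt hpq
  by_cases hz0 : z = 0
  · subst hz0
    have hser : HasFPowerSeriesAt g (FormalMultilinearSeries.ofScalars ℂ b) 0 := by
      refine hasFPowerSeriesAt_iff.2 ?_
      filter_upwards [Metric.ball_mem_nhds (0 : ℂ) hρ] with w hw
      simp only [FormalMultilinearSeries.coeff_ofScalars, smul_eq_mul, zero_add]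
      convert! hg w (mem_ball_zero_iff.1 hw) using 1
      exact funext fun n => mul_comm _ _
    have hd : pqDeriv p q g 0 = b 1 := by
      have := hser.deriv
      rw [pqDeriv, if_pos rfl, this]
      simp [FormalMultilinearSeries.ofScalars]
    rw [hd]
    have := hasSum_single (f := fun n => b (n + 1) * (pqNumber p q (n + 1) : ℂ) * (0 : ℂ) ^ n) 0
      fun n hn => by simp [hn]
    simpa [pqNumber_one] using this
  · have hpz : ‖(p : ℂ) * z‖ < ρ := by
      rw [norm_mul, Complex.norm_real, Real.norm_of_nonneg hp]
      exact (mul_le_mul_of_nonneg_right hpq.le (norm_nonneg z)).trans_lt hz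
    have hqz : ‖(q : ℂ) * z‖ < ρ := by
      rwa [norm_mul, Complex.norm_real, Real.norm_of_nonneg hq.le]
    have hne : (p : ℂ) - q ≠ 0 := by exact_mod_cast (sub_neg.2 hpq).ne
    have h := (hasSum_nat_add_iff' 1).2 ((hg _ hpz).sub (hg _ hqz))
    rw [pqDeriv, if_neg hz0]
    convert! h.div_const ((p : ℂ) * z - q * z) using 1
    · funext n
      have e : (pqNumber p q (n + 1) : ℂ) * (p - q) = p ^ (n + 1) - q ^ (n + 1) := by
        exact_mod_cast pqNumber_mul p q (n + 1)
      rw [← sub_mul, eq_div_iff (mul_ne_zero hne hz0), mul_pow, mul_pow]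
      linear_combination (b (n + 1) * z ^ (n + 1)) * e
    · simp

lemma hasSum_iterate_pqDeriv (hp : 0 ≤ p) (hpq : p < q) {f : ℂ → ℂ} {a : ℕ → ℂ} {ε : ℝ}
    (hε : 0 < ε) (hf : ∀ w : ℂ, ‖w‖ < ε → HasSum (fun n => a n * w ^ n) (f w)) (k : ℕ) :
    ∀ z : ℂ, q ^ k * ‖z‖ < ε → HasSum
      (fun n => a (n + k) * (∏ i ∈ Finset.range k, (pqNumber p q (n + i + 1) : ℂ)) * z ^ n)
      ((pqDeriv p q)^[k] f z) := by
  have hq : 0 < q := hp.trans_lt hpq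
  induction k with
  | zero => intro z hz; simpa using hf z (by simpa using hz)
  | succ k ih =>
    intro z hz
    rw [Function.iterate_succ_apply']
    have h := hasSum_pqDeriv hp hpq (g := (pqDeriv p q)^[k] f) (ρ := ε / q ^ k) (by positivity)
      (fun w hw => ih w (by rw [lt_div_iff₀ (by positivity)] at hw; linarith)) (z := z)
      (by rw [lt_div_iff₀ (by positivity)]; rw [pow_succ] at hz; linarith)
    convert! h using 1
    funext n
    rw [Finset.prod_range_succ', mul_assoc (a _), add_zero, add_right_comm n 1 k, add_assoc n k 1]
    simp only [add_right_comm n 1, ← add_assoc]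
    ring

lemma hasSum_of_differentiableOn {f : ℂ → ℂ} {r ε : ℝ} (hε : 0 < ε) (hεr : ε < r)
    (hf : DifferentiableOn ℂ f (Metric.ball 0 r)) {w : ℂ} (hw : ‖w‖ < ε) :
    HasSum (fun n : ℕ => (2 * Real.pi * Complex.I : ℂ)⁻¹ *
      (∮ ω in C(0, ε), f ω * (ω ^ (n + 1))⁻¹) * w ^ n) (f w) := by
  lift ε to NNReal using hε.le
  have h := DifferentiableOn.hasFPowerSeriesOnBall (R := ε)
    (hf.mono (Metric.closedBall_subset_ball hεr)) (by exact_mod_cast hε)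
  have h2 := h.hasSum (y := w) (by simpa using hw)
  rw [zero_add] at h2
  convert! h2 using 1
  funext n
  rw [cauchyPowerSeries_apply, smul_eq_mul, mul_assoc, mul_comm _ (w ^ n),
    ← circleIntegral.integral_const_mul]
  congr 2
  funext ω
  simp only [sub_zero, smul_eq_mul, pow_succ, mul_inv, div_eq_mul_inv]
  ring

end PowerSeries

/-! ### Termwise integration along rays and circles. -/

section RayAndCircle

lemma integrable_of_hasSum_of_summable_integral_norm {α : Type*} [MeasurableSpace α]
    {μ : Measure α} {F : ℕ → α → ℂ} {g : α → ℂ} (hF : ∀ i, Integrable (F i) μ)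
    (hsum : Summable fun i => ∫ a, ‖F i a‖ ∂μ) (hg : AEStronglyMeasurable g μ)
    (hFg : ∀ᵐ a ∂μ, HasSum (fun i => F i a) (g a)) : Integrable g μ := by
  refine ⟨hg, ?_⟩
  have h1 : ∀ᵐ a ∂μ, ‖g a‖ₑ ≤ ∑' i, ‖F i a‖ₑ := by
    filter_upwards [hFg] with a ha
    refine le_of_tendsto (Filter.Tendsto.enorm ha) (.of_forall fun s => ?_)
    exact (enorm_sum_le _ _).trans (ENNReal.sum_le_tsum s)
  refine (lintegral_mono_ae h1).trans_lt ?_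
  rw [lintegral_tsum fun i => (hF i).1.enorm]
  have h2 : ∀ i, ∫⁻ a, ‖F i a‖ₑ ∂μ = ENNReal.ofReal (∫ a, ‖F i a‖ ∂μ) := fun i =>
    (ofReal_integral_norm_eq_lintegral_enorm (hF i)).symm
  simp_rw [h2]
  rw [← ENNReal.ofReal_tsum_of_nonneg (fun i => integral_nonneg fun a => norm_nonneg _) hsum]
  exact ENNReal.ofReal_lt_top

/-- Termwise integration along a ray of `ζ ^ k * N(zζ) / D(wζ)`. -/
lemma rayIntegral_eq_of_moments {D N : ℂ → ℂ} {e μ : ℕ → ℂ} (hNc : Continuous N)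
    (hN : ∀ v, HasSum (fun n => e n * v ^ n) (N v)) {w z : ℂ} {θ : ℝ} {k : ℕ}
    (hw : w ≠ 0)
    (hint : ∀ n, IntegrableOn
      (fun t : ℝ => (t : ℂ) ^ n / D (t * (w * Complex.exp (θ * Complex.I)))) (Ioi 0))
    (hmom : ∀ n, (w * Complex.exp (θ * Complex.I)) ^ (n + 1) *
      moment D (w * Complex.exp (θ * Complex.I)) n = μ n)
    (hsum : Summable fun m =>
      ‖e m‖ * ‖z‖ ^ m * absMoment D (w * Complex.exp (θ * Complex.I)) (m + k)) :
    RayIntegrable θ (fun ζ => ζ ^ k * (N (z * ζ) / D (w * ζ))) ∧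
    HasSum (fun m => e m * z ^ m * μ (m + k) * (w ^ (m + k + 1))⁻¹)
      (rayIntegral θ (fun ζ => ζ ^ k * (N (z * ζ) / D (w * ζ)))) := by
  set d := Complex.exp (θ * Complex.I) with hd
  have hd0 : d ≠ 0 := Complex.exp_ne_zero _
  have hd1 : ‖d‖ = 1 := Complex.norm_exp_ofReal_mul_I θ
  set F : ℕ → ℝ → ℂ := fun m t => (e m * (z * d) ^ m * d ^ k) *
    ((t : ℂ) ^ (m + k) / D (t * (w * d))) with hF
  set g : ℝ → ℂ := fun t => ((t : ℂ) * d) ^ k * (N (z * (t * d)) / D (w * (t * d))) with hg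
  have hFi : ∀ m, Integrable (F m) (volume.restrict (Ioi 0)) := fun m =>
    (hint (m + k)).const_mul _
  have hFs : Summable fun m => ∫ t in Ioi (0 : ℝ), ‖F m t‖ := by
    refine hsum.congr fun m => ?_
    simp only [hF, norm_mul _ (_ / _), integral_const_mul]
    rw [norm_mul, norm_mul, norm_pow, norm_pow, norm_mul, hd1, mul_one, one_pow, mul_one]
    rfl
  have hFg : ∀ t, HasSum (fun m => F m t) (g t) := fun t => by
    have := (hN (z * (t * d))).mul_left (((t : ℂ) * d) ^ k / D (w * (t * d)))
    convert! this using 1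
    · funext m
      simp only [hF]
      rw [show (t : ℂ) * (w * d) = w * (t * d) by ring]
      ring
    · simp only [hg]; ring
  have hgm : AEStronglyMeasurable g (volume.restrict (Ioi 0)) := by
    have h1 := (hint 0).1
    have h2 : Continuous fun t : ℝ => ((t : ℂ) * d) ^ k * N (z * (t * d)) := by fun_prop
    refine (h2.aestronglyMeasurable.mul h1).congr (.of_forall fun t => ?_)
    simp only [hg, Pi.mul_apply]
    rw [show (t : ℂ) * (w * d) = w * (t * d) by ring]
    ring
  refine ⟨integrable_of_hasSum_of_summable_integral_norm hFi hFs hgm (.of_forall hFg), ?_⟩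
  -- The factor `d` from `dζ` completes `d ^ (m + k + 1)`, which cancels against the moment
  -- identity, so the sum does not depend on the direction.
  have h := (hasSum_integral_of_summable_integral_norm hFi hFs).mul_right d
  convert! h using 1
  · funext m
    have hm := hmom (m + k)
    simp only [hF, integral_const_mul]
    change _ = _ * moment D (w * d) (m + k) * d
    rw [← hm]
    field_simp
    ring
  · rw [rayIntegral, integral_mul_const]
    congr 2
    funext t
    exact (hFg t).tsum_eq.symm

lemma circleIntegral_mul_tsum {f : ℂ → ℂ} {ε : ℝ} (hε : 0 < ε)
    (hf : ContinuousOn f (Metric.sphere 0 ε)) {s : ℕ → ℂ} {k : ℕ}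
    (hs : Summable fun n => ‖s n‖ * (ε ^ (n + k + 1))⁻¹) :
    CircleIntegrable (fun ω => f ω * ∑' n, s n * (ω ^ (n + k + 1))⁻¹) 0 ε ∧
    HasSum (fun n => s n * ∮ ω in C(0, ε), f ω * (ω ^ (n + k + 1))⁻¹)
      (∮ ω in C(0, ε), f ω * ∑' n, s n * (ω ^ (n + k + 1))⁻¹) := by
  have hne : ∀ ω ∈ Metric.sphere (0 : ℂ) ε, ω ≠ 0 := fun ω hω h => by
    rw [mem_sphere_zero_iff_norm, h, norm_zero] at hω
    exact hε.ne hω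
  have hpow : ∀ n, ContinuousOn (fun ω : ℂ => (ω ^ (n + k + 1))⁻¹) (Metric.sphere 0 ε) := fun n =>
    ContinuousOn.inv₀ (by fun_prop) fun ω hω => pow_ne_zero _ (hne ω hω)
  have hnorm : ∀ n, ∀ ω ∈ Metric.sphere (0 : ℂ) ε,
      ‖s n * (ω ^ (n + k + 1))⁻¹‖ = ‖s n‖ * (ε ^ (n + k + 1))⁻¹ := fun n ω hω => by
    rw [norm_mul, norm_inv, norm_pow, mem_sphere_zero_iff_norm.1 hω]
  have hS : ContinuousOn (fun ω : ℂ => ∑' n, s n * (ω ^ (n + k + 1))⁻¹) (Metric.sphere 0 ε) :=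
    continuousOn_tsum (fun n => (hpow n).const_mul _) hs fun n ω hω => (hnorm n ω hω).le
  refine ⟨(hf.mul hS).circleIntegrable hε.le, ?_⟩
  obtain ⟨M, hM⟩ := (isCompact_sphere (0 : ℂ) ε).exists_bound_of_continuousOn hf
  simp only [← circleIntegral.integral_const_mul]
  have hmem : ∀ t, circleMap 0 ε t ∈ Metric.sphere (0 : ℂ) ε := fun t =>
    circleMap_mem_sphere 0 hε.le t
  have hderiv : ∀ t, ‖deriv (circleMap 0 ε) t‖ = ε := fun t => by
    simp [deriv_circleMap, abs_of_pos hε]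
  have hterm : ∀ t, HasSum (fun n => deriv (circleMap 0 ε) t •
      (s n * (f (circleMap 0 ε t) * (circleMap 0 ε t ^ (n + k + 1))⁻¹)))
      (deriv (circleMap 0 ε) t • (f (circleMap 0 ε t) *
        ∑' n, s n * (circleMap 0 ε t ^ (n + k + 1))⁻¹)) := fun t => by
    have h1 : Summable fun n => s n * (circleMap 0 ε t ^ (n + k + 1))⁻¹ :=
      Summable.of_norm (hs.congr fun n => (hnorm n _ (hmem t)).symm)
    have h2 := (h1.hasSum.mul_left (f (circleMap 0 ε t))).const_smul (deriv (circleMap 0 ε) t)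
    convert! h2 using 1
    funext n
    congr 1
    ring
  refine intervalIntegral.hasSum_integral_of_dominated_convergence
    (fun n _ => ε * M * (‖s n‖ * (ε ^ (n + k + 1))⁻¹)) (fun n => ?_) (fun n => ?_) ?_ ?_ ?_
  · refine Continuous.aestronglyMeasurable ?_
    have h1 : Continuous fun t => f (circleMap 0 ε t) :=
      hf.comp_continuous (continuous_circleMap 0 ε) hmem
    have h2 : Continuous fun t => (circleMap 0 ε t ^ (n + k + 1))⁻¹ :=
      (hpow n).comp_continuous (continuous_circleMap 0 ε) hmem
    have h3 : Continuous fun t => deriv (circleMap 0 ε) t := by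
      simp only [deriv_circleMap]
      have := continuous_circleMap 0 ε
      fun_prop
    exact h3.smul (continuous_const.mul (h1.mul h2))
  · refine .of_forall fun t _ => ?_
    beta_reduce
    rw [norm_smul, hderiv, mul_left_comm (s n), norm_mul, hnorm n _ (hmem t), mul_assoc ε]
    gcongr
    exact hM _ (hmem t)
  · exact .of_forall fun t _ => hs.mul_left _
  · exact intervalIntegrable_const
  · exact .of_forall fun t _ => hterm t

lemma IsGoodDirection.mul_exp_mem_slitPlane {ω : ℂ} {θ : ℝ} (h : IsGoodDirection ω θ)
    (hω : ω ≠ 0) : ω * Complex.exp (θ * Complex.I) ∈ Complex.slitPlane := by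
  have e1 : ω * Complex.exp (θ * Complex.I) =
      (‖ω‖ : ℂ) * Complex.exp (((Complex.arg ω + θ : ℝ) : ℂ) * Complex.I) := by
    conv_lhs => rw [← Complex.norm_mul_exp_arg_mul_I ω]
    rw [mul_assoc, ← Complex.exp_add]
    push_cast
    ring_nf
  rw [e1]
  refine ofReal_mul_mem_slitPlane (norm_pos_iff.2 hω) ?_
  rw [Complex.mem_slitPlane_iff, Complex.exp_ofReal_mul_I_re, Complex.exp_ofReal_mul_I_im]
  by_contra hcon
  push Not at hcon
  obtain ⟨hcos, hsin⟩ := hcon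
  obtain ⟨n, hn⟩ := Real.sin_eq_zero_iff.1 hsin
  rw [← hn] at hcos
  rcases Int.even_or_odd' n with ⟨m, hm | hm⟩
  · rw [hm, show ((2 * m : ℤ) : ℝ) * Real.pi = m * (2 * Real.pi) by push_cast; ring,
      Real.cos_int_mul_two_pi] at hcos
    linarith
  · refine h m ?_
    rw [← hn, hm]
    push_cast
    ring

/-- The integral formula for a function whose power series coefficients are given by Cauchy
integrals, multiplied by moments of `1 / D`. -/
theorem eq_circleIntegral_rayIntegral {D N : ℂ → ℂ} {e μ : ℕ → ℂ} {s ε : ℝ} (hs : 0 < s)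
    (hε : 0 < ε) (hNc : Continuous N) (hN : ∀ v, HasSum (fun n => e n * v ^ n) (N v))
    (hint : ∀ c ∈ Complex.slitPlane, ∀ n,
      IntegrableOn (fun t : ℝ => (t : ℂ) ^ n / D (t * c)) (Ioi 0))
    (hmom : ∀ c ∈ Complex.slitPlane, ∀ n, c ^ (n + 1) * moment D c n = μ n)
    {z : ℂ} {k : ℕ}
    (hsum : ∀ c ∈ Complex.slitPlane, ‖c‖ = s * ε →
      Summable fun m => ‖e m‖ * ‖z‖ ^ m * absMoment D c (m + k))
    {f : ℂ → ℂ} (hf : ContinuousOn f (Metric.sphere 0 ε)) {θ : ℂ → ℝ}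
    (hθ : {ω : ℂ | ‖ω‖ = ε ∧ ¬ IsGoodDirection ω (θ ω)}.Finite) {κ : ℂ} {C : ℕ → ℂ}
    (hC : ∀ n, κ * (e n * μ (n + k) / (s : ℂ) ^ (n + k + 1)) =
      (2 * Real.pi * Complex.I : ℂ)⁻¹ * C n) {v : ℂ}
    (hv : HasSum (fun n => (2 * Real.pi * Complex.I : ℂ)⁻¹ *
      (∮ ω in C(0, ε), f ω * (ω ^ (n + k + 1))⁻¹) * C n * z ^ n) v) :
    (∀ ω : ℂ, ‖ω‖ = ε → IsGoodDirection ω (θ ω) →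
      RayIntegrable (θ ω) (fun ζ => ζ ^ k * (N (z * ζ) / D (s * ω * ζ)))) ∧
    CircleIntegrable (fun ω => f ω * rayIntegral (θ ω)
      (fun ζ => ζ ^ k * (N (z * ζ) / D (s * ω * ζ)))) 0 ε ∧
    v = κ * ∮ ω in C(0, ε), f ω * rayIntegral (θ ω)
      (fun ζ => ζ ^ k * (N (z * ζ) / D (s * ω * ζ))) := by
  have hsC : (s : ℂ) ≠ 0 := by exact_mod_cast hs.ne'
  have hsn : ‖(s : ℂ)‖ = s := by rw [Complex.norm_real, Real.norm_of_nonneg hs.le]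
  set σ : ℕ → ℂ := fun n => e n * z ^ n * μ (n + k) * ((s : ℂ) ^ (n + k + 1))⁻¹ with hσ
  have hray : ∀ ω : ℂ, ‖ω‖ = ε → IsGoodDirection ω (θ ω) →
      RayIntegrable (θ ω) (fun ζ => ζ ^ k * (N (z * ζ) / D (s * ω * ζ))) ∧
      rayIntegral (θ ω) (fun ζ => ζ ^ k * (N (z * ζ) / D (s * ω * ζ))) =
        ∑' n, σ n * (ω ^ (n + k + 1))⁻¹ := by
    intro ω hω hgood
    have hω0 : ω ≠ 0 := by
      rintro rfl
      rw [norm_zero] at hω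
      exact hε.ne hω
    have hc : (s : ℂ) * ω * Complex.exp (θ ω * Complex.I) ∈ Complex.slitPlane := by
      rw [mul_assoc]
      exact ofReal_mul_mem_slitPlane hs (hgood.mul_exp_mem_slitPlane hω0)
    have hcn : ‖(s : ℂ) * ω * Complex.exp (θ ω * Complex.I)‖ = s * ε := by
      rw [norm_mul, norm_mul, Complex.norm_exp_ofReal_mul_I, hsn, hω, mul_one]
    obtain ⟨h1, h2⟩ := rayIntegral_eq_of_moments hNc hN (mul_ne_zero hsC hω0) (hint _ hc)
      (hmom _ hc) (hsum _ hc hcn)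
    refine ⟨h1, h2.tsum_eq.symm.trans (tsum_congr fun n => ?_)⟩
    simp only [hσ]
    rw [mul_pow, mul_inv]
    ring
  have hσs : Summable fun n => ‖σ n‖ * (ε ^ (n + k + 1))⁻¹ := by
    -- `μ` does not depend on `c`, so it may be estimated at the positive real point `c = s * ε`.
    have hc : ((s * ε : ℝ) : ℂ) ∈ Complex.slitPlane := Complex.ofReal_mem_slitPlane.2 (by positivity)
    have hcn : ‖((s * ε : ℝ) : ℂ)‖ = s * ε := by
      rw [Complex.norm_real, Real.norm_of_nonneg (by positivity)]
    refine (hsum _ hc hcn).of_nonneg_of_le (fun n => by positivity) fun n => ?_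
    simp only [hσ]
    rw [norm_mul, norm_mul, norm_mul, ← hmom _ hc, norm_mul, norm_pow, norm_pow, hcn, norm_inv,
      norm_pow, hsn, mul_pow]
    have : ‖moment D ((s * ε : ℝ) : ℂ) (n + k)‖ ≤ absMoment D ((s * ε : ℝ) : ℂ) (n + k) :=
      norm_integral_le_integral_norm _
    calc _ = ‖e n‖ * ‖z‖ ^ n * ‖moment D ((s * ε : ℝ) : ℂ) (n + k)‖ := by field_simp
      _ ≤ _ := by gcongr
  obtain ⟨hci, hcs⟩ := circleIntegral_mul_tsum hε hf hσs
  -- Off a finite set the ray integral equals a series free of `θ`; hence no regularity of `ω ↦ θ ω`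
  -- is needed.
  have hae : (fun ω => f ω * ∑' n, σ n * (ω ^ (n + k + 1))⁻¹)
      =ᶠ[codiscreteWithin (Metric.sphere 0 |ε|)]
      fun ω => f ω * rayIntegral (θ ω) (fun ζ => ζ ^ k * (N (z * ζ) / D (s * ω * ζ))) := by
    rw [abs_of_pos hε]
    filter_upwards [compl_finite_mem_codiscreteWithin hθ,
      Filter.self_mem_codiscreteWithin (Metric.sphere (0 : ℂ) ε)] with ω h1 h2
    rw [mem_sphere_zero_iff_norm] at h2
    by_cases hgood : IsGoodDirection ω (θ ω)
    · rw [(hray ω h2 hgood).2]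
    · exact absurd ⟨h2, hgood⟩ h1
  refine ⟨fun ω hω hg => (hray ω hω hg).1, hci.congr_codiscreteWithin hae, ?_⟩
  rw [← circleIntegral.circleIntegral_congr_codiscreteWithin hae hε.ne']
  refine hv.unique ?_
  convert! hcs.mul_left κ using 1
  funext n
  have := hC n
  simp only [hσ]
  linear_combination (-(∮ ω in C(0, ε), f ω * (ω ^ (n + k + 1))⁻¹) * z ^ n) * this

end RayAndCircle

/-! ### Growth exponent, products of `(p,q)`-numbers, and summability. -/

lemma norm_qE_le_norm_qTheta {q : ℝ} (hq : 1 < q) {z : ℂ} (hz : z ≠ 0) :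
    ‖qE q z‖ ≤ ‖qTheta q (‖z‖ * 1)‖ := by
  have hq0 : 0 < q := by linarith
  have hz0 : 0 < ‖z‖ := norm_pos_iff.2 hz
  set S : ℝ → ℝ := fun t => ∑' n : ℕ, (q ^ (n * (n - 1) / 2))⁻¹ * t ^ n with hS
  have hsum : ∀ t, HasSum (fun n : ℕ => (q ^ (n * (n - 1) / 2))⁻¹ * t ^ n) (S t) := fun t => by
    refine Summable.hasSum ((summable_qE_norm hq t).congr fun n => ?_)
    rw [norm_inv, norm_pow, Complex.norm_real, Real.norm_of_nonneg hq0.le]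
  have hreal : ∀ t : ℝ, qE q t = S t := fun t => by
    refine (hasSum_qE hq t).unique ?_
    have := Complex.hasSum_ofReal.2 (hsum t)
    push_cast at this
    exact this
  have h1 : ‖qE q z‖ ≤ S ‖z‖ := by
    rw [← (hasSum_qE hq z).tsum_eq]
    refine tsum_of_norm_bounded (hsum ‖z‖) fun n => le_of_eq ?_
    rw [norm_mul, norm_inv, norm_pow, norm_pow, Complex.norm_real, Real.norm_of_nonneg hq0.le]
  have h2 : 1 + ‖z‖⁻¹ ≤ S ‖z‖⁻¹ := by
    have := sum_le_hasSum (Finset.range 2) (fun n _ => by positivity) (hsum ‖z‖⁻¹)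
    simpa [Finset.sum_range_succ] using this
  have h3 : qTheta q (‖z‖ * 1) = ((S ‖z‖ + ‖z‖ * S ‖z‖⁻¹ - ‖z‖ - 1 : ℝ) : ℂ) := by
    rw [mul_one, qTheta_eq hq (by exact_mod_cast hz0.ne'), ← Complex.ofReal_inv, hreal, hreal]
    push_cast
    rfl
  rw [h3, Complex.norm_real]
  refine h1.trans (le_trans ?_ (Real.le_norm_self _))
  have h4 := mul_le_mul_of_nonneg_left h2 hz0.le
  rw [mul_add, mul_inv_cancel₀ hz0.ne'] at h4
  linarith

/-- The comparison function `w` satisfies the same equation `w (qt) = q t w t` as `Θ_q`; the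
exponent `1 / 2` is what makes this exact. So `w / |Θ_q|` is invariant under `t ↦ qt`, hence bounded
below on `(0, ∞)`, and `|E_q(z)| ≤ Θ_q(|z|)`. -/
lemma isGrowthExponent_half {q : ℝ} (hq : 1 < q) : IsGrowthExponent q (1 / 2) := by
  have hq0 : 0 < q := by linarith
  have hlq : 0 < Real.log q := Real.log_pos hq
  have h1 : (1 : ℂ) ∈ Complex.slitPlane := Complex.one_mem_slitPlane
  set w : ℝ → ℝ := fun t => Real.exp (Real.log t ^ 2 / (2 * Real.log q) + Real.log t / 2) with hw
  have hwq : ∀ t, 0 < t → w (q * t) = q * t * w t := fun t ht => by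
    simp only [hw]
    rw [Real.log_mul hq0.ne' ht.ne', ← Real.exp_log (mul_pos hq0 ht), ← Real.exp_add,
      Real.log_mul hq0.ne' ht.ne']
    congr 1
    field_simp
    ring
  set g : ℝ → ℝ := fun t => w t / ‖qTheta q (t * 1)‖ with hg
  have hth : ∀ t : ℝ, 0 < t → 0 < ‖qTheta q (t * 1)‖ := fun t ht =>
    norm_pos_iff.2 (qTheta_ne_zero hq (ofReal_mul_mem_slitPlane ht h1))
  have hgpos : ∀ t, 0 < t → 0 < g t := fun t ht => div_pos (Real.exp_pos _) (hth t ht)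
  have hgq : ∀ t, 0 < t → g (q * t) = g t := fun t ht => by
    have := hth t ht
    simp only [hg]
    rw [hwq t ht, qTheta_mul_ray hq h1 ht, norm_mul, norm_mul, mul_one, Complex.norm_real,
      Complex.norm_real, Real.norm_of_nonneg hq0.le, Real.norm_of_nonneg ht.le,
      mul_div_mul_left _ _ (by positivity)]
  have hgc : ContinuousOn g (Ioi 0) := by
    have hlog : ContinuousOn Real.log (Ioi 0) :=
      Real.continuousOn_log.mono fun t (ht : 0 < t) => ht.ne'
    have hwc : ContinuousOn w (Ioi 0) := by fun_prop
    exact hwc.div (continuousOn_qTheta_ray hq h1).norm fun t ht => (hth t ht).ne'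
  obtain ⟨k₁, hk₁, h₁⟩ := exists_pos_le_of_le_comp_mul hq one_pos hgc hgpos
    (fun t ht => (hgq t (by linarith)).ge) one_pos
  obtain ⟨k₂, hk₂, h₂⟩ := exists_pos_le_of_le_comp_mul hq (g := fun t => g t⁻¹) one_pos
    (hgc.comp (continuousOn_inv₀.mono fun t (ht : 0 < t) => ht.ne')
      fun t ht => mem_Ioi.2 (inv_pos.2 (mem_Ioi.1 ht)))
    (fun t ht => hgpos _ (inv_pos.2 ht)) (fun t ht => by
      have ht0 : 0 < t := by linarith
      have := hgq (q * t)⁻¹ (by positivity)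
      rw [show q * (q * t)⁻¹ = t⁻¹ by field_simp] at this
      exact this.le) one_pos
  have hk : 0 < min k₁ k₂ := lt_min hk₁ hk₂
  refine ⟨(min k₁ k₂)⁻¹, inv_pos.2 hk, fun z hz => (norm_qE_le_norm_qTheta hq hz).trans ?_⟩
  have hz0 : 0 < ‖z‖ := norm_pos_iff.2 hz
  have hle : min k₁ k₂ ≤ g ‖z‖ := by
    rcases le_total 1 ‖z‖ with h | h
    · exact (min_le_left _ _).trans (h₁ _ h)
    · have := h₂ ‖z‖⁻¹ ((one_le_inv₀ hz0).2 h)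
      simp only [inv_inv] at this
      exact (min_le_right _ _).trans this
  rw [hg, le_div_iff₀ (hth _ hz0)] at hle
  rw [Real.rpow_def_of_pos hz0, mul_assoc, ← Real.exp_add, ← div_eq_inv_mul, le_div_iff₀ hk,
    mul_comm, mul_one_div]
  exact hle

lemma pqNumber_zero_succ {q : ℝ} (hq : q ≠ 0) (n : ℕ) : pqNumber 0 q (n + 1) = q ^ n := by
  have h := pqNumber_mul 0 q (n + 1)
  refine mul_right_cancel₀ hq ?_
  simp only [zero_sub, zero_pow (Nat.succ_ne_zero n)] at h
  rw [← pow_succ]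
  linarith

lemma prod_pqNumber_zero {q : ℝ} (hq : q ≠ 0) (n k : ℕ) :
    (∏ i ∈ Finset.range k, pqNumber 0 q (n + i + 1)) * q ^ (n * (n - 1) / 2) =
      q ^ ((n + k) * (n + k - 1) / 2) := by
  induction k with
  | zero => simp
  | succ k ih =>
    rw [Finset.prod_range_succ, mul_right_comm, ih, pqNumber_zero_succ hq, ← add_assoc n k 1,
      Nat.triangle_succ, ← pow_add]

lemma pqNumber_succ {p : ℝ} (hp : p ≠ 0) {q : ℝ} (hpq : p ≠ q) (n : ℕ) :
    pqNumber p q (n + 1) = p ^ n * qNumber (q / p) (n + 1) := by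
  refine mul_right_cancel₀ (sub_ne_zero.2 hpq) ?_
  have h := qNumber_mul (q / p) (n + 1)
  rw [pqNumber_mul, show p - q = -p * (q / p - 1) by field_simp; ring,
    show p ^ n * qNumber (q / p) (n + 1) * (-p * (q / p - 1)) =
      -p ^ (n + 1) * (qNumber (q / p) (n + 1) * (q / p - 1)) by ring, h, div_pow]
  field_simp
  ring

lemma prod_pqNumber {p : ℝ} (hp : p ≠ 0) {q : ℝ} (hpq : p ≠ q) (n k : ℕ) :
    (∏ i ∈ Finset.range k, pqNumber p q (n + i + 1)) * qFactorial (q / p) n =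
      (p ^ k) ^ n * p ^ (k * (k - 1) / 2) * qFactorial (q / p) (n + k) := by
  induction k with
  | zero => simp
  | succ k ih =>
    rw [Finset.prod_range_succ, mul_right_comm, ih, pqNumber_succ hp hpq, ← add_assoc n k 1,
      Nat.triangle_succ, qFactorial_succ]
    ring

lemma summable_absMoment_qTheta {q ε : ℝ} (hq : 1 < q) (hε : 0 < ε) {z c : ℂ} {k : ℕ}
    (hz : q ^ k * ‖z‖ < ε) (hc : c ∈ Complex.slitPlane) (hcn : ‖c‖ = q * ε) :
    Summable fun m : ℕ => ‖((q : ℂ) ^ (m * (m - 1) / 2))⁻¹‖ * ‖z‖ ^ m *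
      absMoment (qTheta q) c (m + k) := by
  have hq0 : 0 < q := by linarith
  -- The coefficients contribute `q⁻ᵐ` and the moments `q ^ (m + k) / ε`, so the ratio is constant.
  refine summable_of_norm_succ_le (ρ := fun _ => q ^ k * ‖z‖ / ε) ((div_lt_one hε).2 hz)
    tendsto_const_nhds fun m => le_of_eq ?_
  have hA : ∀ n, 0 ≤ absMoment (qTheta q) c n := fun n => integral_nonneg fun t => norm_nonneg _
  have h := absMoment_qTheta_succ hq hc (m + k)
  have h' : absMoment (qTheta q) c (m + 1 + k) =
      q ^ (m + k + 1) * absMoment (qTheta q) c (m + k) / (q * ε) := by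
    rw [eq_div_iff (by positivity), ← h, hcn, add_right_comm m 1 k]
    ring
  rw [h', Nat.triangle_succ, Real.norm_of_nonneg (mul_nonneg (by positivity) (hA _)),
    Real.norm_of_nonneg (mul_nonneg (by positivity)
      (div_nonneg (mul_nonneg (by positivity) (hA _)) (by positivity)))]
  simp only [norm_inv, norm_pow, Complex.norm_real, Real.norm_of_nonneg hq0.le]
  field_simp
  ring

lemma summable_absMoment_qExp {x ε : ℝ} (hx : 1 < x) (hε : 0 < ε) {z c : ℂ} {k : ℕ}
    (hz : x ^ k * ‖z‖ < ε) (hc : c ∈ Complex.slitPlane) (hcn : ‖c‖ = x * ε) :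
    Summable fun m : ℕ => ‖((qFactorial x m : ℂ))⁻¹‖ * ‖z‖ ^ m *
      absMoment (qExp x) c (m + k) := by
  have hx0 : 0 < x := by linarith
  have hx1 : 0 < x - 1 := by linarith
  have hA : ∀ n, 0 ≤ absMoment (qExp x) c n := fun n => integral_nonneg fun t => norm_nonneg _
  have hlim : Tendsto (fun m : ℕ => ‖z‖ / ε * ((x ^ (m + k + 1) + 1) / (x ^ (m + 1) - 1))) atTop
      (𝓝 (‖z‖ / ε * ((x ^ k + 0) / (1 - 0)))) := by
    have h0 : Tendsto (fun m : ℕ => x⁻¹ ^ (m + 1)) atTop (𝓝 0) :=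
      (tendsto_pow_atTop_nhds_zero_of_lt_one (by positivity) (inv_lt_one_of_one_lt₀ hx)).comp
        (tendsto_add_atTop_nat 1)
    refine (((h0.const_add (x ^ k)).div (h0.const_sub 1) (by norm_num)).const_mul _).congr
      fun m => ?_
    congr 1
    have h1 : x ^ (m + 1) ≠ 0 := by positivity
    have h2 : x ^ (m + 1) - 1 ≠ 0 := (sub_pos.2 (one_lt_pow₀ hx (by simp))).ne'
    rw [add_right_comm m k 1, pow_add x (m + 1) k]
    simp only [Pi.div_apply, inv_pow]
    rw [show 1 - (x ^ (m + 1))⁻¹ = (x ^ (m + 1) - 1) / x ^ (m + 1) by field_simp,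
      show x ^ k + (x ^ (m + 1))⁻¹ = (x ^ (m + 1) * x ^ k + 1) / x ^ (m + 1) by field_simp,
      div_div_div_cancel_right₀ h1]
  refine summable_of_norm_succ_le ?_ hlim fun m => ?_
  · rw [add_zero, sub_zero, div_one, div_mul_eq_mul_div, div_lt_one hε, mul_comm]
    exact hz
  have h := absMoment_qExp_succ_le hx hc (m + k)
  have hF := qFactorial_pos hx m
  have hN := qNumber_succ_pos hx m
  have h2 : 0 < x ^ (m + 1) - 1 := sub_pos.2 (one_lt_pow₀ hx (by simp))
  have e := qNumber_mul x (m + 1)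
  rw [Real.norm_of_nonneg (mul_nonneg (by positivity) (hA _)),
    Real.norm_of_nonneg (mul_nonneg (by positivity) (hA _)), qFactorial_succ]
  simp only [norm_inv, Complex.norm_real, Real.norm_of_nonneg hF.le,
    Real.norm_of_nonneg (mul_pos hF hN).le]
  have h' : absMoment (qExp x) c (m + 1 + k) ≤
      (x ^ (m + k + 1) + 1) * absMoment (qExp x) c (m + k) / ((x - 1) * ε) := by
    rw [le_div_iff₀ (by positivity), add_right_comm m 1 k]
    rw [hcn] at h
    refine le_of_mul_le_mul_left ?_ hx0
    calc _ = (x - 1) * (x * ε) * absMoment (qExp x) c (m + k + 1) := by ring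
      _ ≤ _ := h
      _ = _ := by ring
  calc _ ≤ (qFactorial x m * qNumber x (m + 1))⁻¹ * ‖z‖ ^ (m + 1) *
        ((x ^ (m + k + 1) + 1) * absMoment (qExp x) c (m + k) / ((x - 1) * ε)) := by gcongr
    _ = _ := by
      rw [← e]
      field_simp
      ring

end PQ

end

/-! ### The two integral formulas. -/

theorem corollary1 (p q : ℝ) (hp : 0 ≤ p) (hpq : p < q)
    (r ε : ℝ) (hε : 0 < ε) (hεr : ε < r)
    (f : ℂ → ℂ) (hf : DifferentiableOn ℂ f (Metric.ball 0 r)) (k : ℕ)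
    (θ : ℂ → ℝ) (hθ : {ω : ℂ | ‖ω‖ = ε ∧ ¬ PQ.IsGoodDirection ω (θ ω)}.Finite) :
    (p = 0 → 1 < q →
      (∃ α : ℝ, PQ.IsGrowthExponent q α) ∧
      ∀ α : ℝ, PQ.IsGrowthExponent q α →
      ∀ z : ℂ, ‖z‖ < (q ^ k)⁻¹ * ε * min 1 (q ^ ((1 : ℝ) / 2 - α)) →
        (∀ ω : ℂ, ‖ω‖ = ε → PQ.IsGoodDirection ω (θ ω) →
          PQ.RayIntegrable (θ ω)
            (fun ζ => ζ ^ k * (PQ.qE q (z * ζ) / PQ.qTheta q ((q : ℂ) * ω * ζ)))) ∧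
        CircleIntegrable (fun ω => f ω * PQ.rayIntegral (θ ω)
            (fun ζ => ζ ^ k * (PQ.qE q (z * ζ) / PQ.qTheta q ((q : ℂ) * ω * ζ)))) 0 ε ∧
        (PQ.pqDeriv p q)^[k] f z =
          (q : ℂ) / (2 * (Real.log q : ℂ) * (Real.pi : ℂ) * Complex.I) *
            ∮ ω in C(0, ε), f ω * PQ.rayIntegral (θ ω)
              (fun ζ => ζ ^ k * (PQ.qE q (z * ζ) / PQ.qTheta q ((q : ℂ) * ω * ζ)))) ∧
    (0 < p →
      ∀ z : ℂ, ‖z‖ < (q ^ k)⁻¹ * ε →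
        (∀ ω : ℂ, ‖ω‖ = ε → PQ.IsGoodDirection ω (θ ω) →
          PQ.RayIntegrable (θ ω)
            (fun ζ => ζ ^ k * (PQ.qExp (q / p) ((p : ℂ) ^ k * z * ζ) /
              PQ.qExp (q / p) ((q : ℂ) / (p : ℂ) * ω * ζ)))) ∧
        CircleIntegrable (fun ω => f ω * PQ.rayIntegral (θ ω)
            (fun ζ => ζ ^ k * (PQ.qExp (q / p) ((p : ℂ) ^ k * z * ζ) /
              PQ.qExp (q / p) ((q : ℂ) / (p : ℂ) * ω * ζ)))) 0 ε ∧
        (PQ.pqDeriv p q)^[k] f z =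
          (p : ℂ) ^ (k * (k - 1) / 2) * ((q : ℂ) / (p : ℂ) - 1) /
              (2 * (Real.log (q / p) : ℂ) * (Real.pi : ℂ) * Complex.I) *
            ∮ ω in C(0, ε), f ω * PQ.rayIntegral (θ ω)
              (fun ζ => ζ ^ k * (PQ.qExp (q / p) ((p : ℂ) ^ k * z * ζ) /
                PQ.qExp (q / p) ((q : ℂ) / (p : ℂ) * ω * ζ)))) := by
  have hq0 : 0 < q := hp.trans_lt hpq
  have hqC : (q : ℂ) ≠ 0 := by exact_mod_cast hq0.ne'
  have hπ : (Real.pi : ℂ) ≠ 0 := by exact_mod_cast Real.pi_ne_zero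
  have hfs : ContinuousOn f (Metric.sphere 0 ε) :=
    hf.continuousOn.mono (Metric.sphere_subset_closedBall.trans (Metric.closedBall_subset_ball hεr))
  have hpow : ∀ z : ℂ, ‖z‖ < (q ^ k)⁻¹ * ε → q ^ k * ‖z‖ < ε := fun z hz => by
    rwa [← div_eq_inv_mul, lt_div_iff₀ (by positivity), mul_comm] at hz
  have hser : ∀ z : ℂ, ‖z‖ < (q ^ k)⁻¹ * ε → _ := fun z hz =>
    PQ.hasSum_iterate_pqDeriv hp hpq hε
      (fun w hw => PQ.hasSum_of_differentiableOn hε hεr hf hw) k z (hpow z hz)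
  refine ⟨fun hp0 hq => ⟨⟨_, PQ.isGrowthExponent_half hq⟩, fun α _ z hz => ?_⟩, fun hp0 z hz => ?_⟩
  -- The minimum is at most `1`, so `z` lies in the disc `q ^ k * ‖z‖ < ε` on which the series
  -- argument works.
  · have hz' : ‖z‖ < (q ^ k)⁻¹ * ε :=
      hz.trans_le (mul_le_of_le_one_right (by positivity) (min_le_left _ _))
    have hlog : (Real.log q : ℂ) ≠ 0 := by exact_mod_cast (Real.log_pos hq).ne'
    subst hp0
    refine PQ.eq_circleIntegral_rayIntegral hq0 hε (PQ.continuous_qE hq) (PQ.hasSum_qE hq)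
      (fun c hc n => PQ.integrableOn_qTheta hq hc n) (fun c hc n => PQ.moment_qTheta hq hc n)
      (fun c hc hcn => PQ.summable_absMoment_qTheta hq hε (hpow z hz') hc hcn) hfs hθ
      (fun n => ?_) (hser z hz')
    have h := PQ.prod_pqNumber_zero hq0.ne' n k
    have h' : (∏ i ∈ Finset.range k, (PQ.pqNumber 0 q (n + i + 1) : ℂ)) *
        (q : ℂ) ^ (n * (n - 1) / 2) = (q : ℂ) ^ ((n + k) * (n + k - 1) / 2) := by
      exact_mod_cast h
    rw [pow_add _ ((n + k) * (n + k - 1) / 2), ← h']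
    field_simp
    ring
  · have hx : 1 < q / p := (one_lt_div hp0).2 hpq
    have hx0 : 0 < q / p := by linarith
    have hpC : (p : ℂ) ≠ 0 := by exact_mod_cast hp0.ne'
    have hlog : (Real.log (q / p) : ℂ) ≠ 0 := by exact_mod_cast (Real.log_pos hx).ne'
    have hx1 : ((q / p : ℝ) : ℂ) - 1 ≠ 0 := by exact_mod_cast (sub_pos.2 hx).ne'
    have hxC : ((q / p : ℝ) : ℂ) ≠ 0 := by exact_mod_cast hx0.ne'
    have hF : ∀ n, (PQ.qFactorial (q / p) n : ℂ) ≠ 0 := fun n => by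
      exact_mod_cast (PQ.qFactorial_pos hx n).ne'
    have hprod : ∀ n, (∏ i ∈ Finset.range k, (PQ.pqNumber p q (n + i + 1) : ℂ)) =
        (p : ℂ) ^ (k * (k - 1) / 2) * PQ.qFactorial (q / p) (n + k) / PQ.qFactorial (q / p) n *
          ((p : ℂ) ^ k) ^ n := fun n => by
      have h := PQ.prod_pqNumber hp0.ne' hpq.ne n k
      have h' : (∏ i ∈ Finset.range k, (PQ.pqNumber p q (n + i + 1) : ℂ)) *
          PQ.qFactorial (q / p) n = ((p : ℂ) ^ k) ^ n * (p : ℂ) ^ (k * (k - 1) / 2) *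
            PQ.qFactorial (q / p) (n + k) := by
        exact_mod_cast h
      have := hF n
      field_simp
      linear_combination h'
    have hz' : (q / p) ^ k * ‖(p : ℂ) ^ k * z‖ < ε := by
      rw [norm_mul, norm_pow, Complex.norm_real, Real.norm_of_nonneg hp, ← mul_assoc, ← mul_pow,
        div_mul_cancel₀ _ hp0.ne']
      exact hpow z hz
    rw [← Complex.ofReal_div]
    refine PQ.eq_circleIntegral_rayIntegral hx0 hε (PQ.continuous_qExp hx) (PQ.hasSum_qExp hx)
      (fun c hc n => PQ.integrableOn_qExp hx hc n) (fun c hc n => PQ.moment_qExp hx hc n)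
      (fun c hc hcn => PQ.summable_absMoment_qExp hx hε hz' hc hcn) hfs hθ
      -- The remaining factor `(p ^ k) ^ n` of the product is absorbed into the argument `p ^ k *
      -- z`.
      (C := fun n => (p : ℂ) ^ (k * (k - 1) / 2) * PQ.qFactorial (q / p) (n + k) /
        PQ.qFactorial (q / p) n) (fun n => ?_) ?_
    · have := hF n
      generalize ((q / p : ℝ) : ℂ) = x at *
      field_simp
      ring
    · convert! hser z hz using 1
      funext n
      rw [hprod, mul_pow]
      ring
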